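/- For a symmetric matrix $\theta\in\mathbb R^{p\times p}$ let $f_\theta(x)\propto\exp\big(\sum_j\theta_{jj}x_j+\sum_{i<j}\theta_{ij}x_ix_j\big)$, $x\in\{0,1\}^p$, be the Ising probability mass function. Let the rows of $Z\in\{0,1\}^{n\times p}$ be i.i.d. with law $f_{\theta_\star}$, $\theta_\star$ symmetric, and write $\mathbb E^{(n)}$ for the expectation over $Z$. Let $$q_{n,\theta}(Z)=\prod_{j=1}^p\prod_{i=1}^n\frac{\exp\big(Z_{ij}(\theta_{jj}+\sum_{k\ne j}\theta_{kj}Z_{ik})\big)}{1+\exp\big(\theta_{jj}+\sum_{k\neq j}\theta_{kj}Z_{ik}\big)},\qquad\theta\in\mathbb R^{p\times p},$$ and let $\check\Pi(\cdot\mid Z)$ be the probability measure on $\mathbb R^{p\times p}$ given by $$\check\Pi(d\theta\mid Z)\propto q_{n,\theta}(Z)\prod_{j=1}^p\sum_{\delta\in\{0,1\}^p}\pi_\delta\Big(\frac\rho2\Big)^{\|\delta\|_0}e^{-\rho\|\theta_{\cdot j}\|_1}\mu_{p,\delta}(d\theta_{\cdot j}),\qquad \rho=24\sqrt{n\log p},$$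 where $\theta_{\cdot j}$ is the $j$-th column, $\|\cdot\|_0$ counts nonzero coordinates, and $\mu_{p,\delta}$ is the product over $k$ of Lebesgue measure on $\mathbb R$ (if $\delta_k=1$) or the Dirac mass at $0$ (if $\delta_k=0$). The prior weights are $\pi_\delta=g_{\|\delta\|_0}\binom p{\|\delta\|_0}^{-1}$, where $g$ is a probability distribution on $\{0,\dots,p\}$ with $c_1p^{-c_3}g_{s-1}\le g_s\le c_2p^{-c_4}g_{s-1}$ for $1\le s\le p$, and $c_1,c_2>0$, $c_3\ge c_4>0$ are constants. With $g(x)=\log(1+e^x)$ (the logistic function, not the distribution above), $X\sim f_{\theta_\star}$, and $X_{(j)}$ the vector $X$ with $j$-th coordinate replaced by $1$, let $\mathcal H^{(j)}=\mathbb E\big[g''(\langle\theta_{\star\cdot j},X_{(j)}\rangle)X_{(j)}X_{(j)}'\big]$ and $$\underline\kappa_2(s)=\min_j\inf\Big\{\frac{u'\mathcal H^{(j)}u}{\|u\|_2^2}:u\ne0,\ \|u\|_0\le s\Big\},\qquad \underline\kappa_2=\min_j\inf\Big\{\frac{u'\mathcal H^{(j)}u}{\|u\|_2^2}:u\ne0,\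 \sum_{k:\theta_{\star kj}=0}|u_k|\le7\sum_{k:\theta_{\star kj}\ne0}|u_k|\Big\}$$ (with $\inf\emptyset=+\infty$). Put $s_{\star j}=\|\theta_{\star\cdot j}\|_0$, $$\zeta_j=s_{\star j}+\frac4{c_4}+\frac2{c_4}\Big(1+\frac{4608}{\underline\kappa_2}+\frac{s_{\star j}}{64(\log p)^2}+\frac{\log(4e)}{\log p}\Big)s_{\star j},\qquad \bar s_j=\lceil s_{\star j}+\zeta_j\rceil,\qquad \bar s=\max_j\bar s_j,$$ and $\underline\kappa=\min(\underline\kappa_2,\underline\kappa_2(\bar s))$. There are universal constants $A_1,A_2>0$ such that, for all constants $c_1,\dots,c_4$ as above, there are $M_0>2$ and $p_0$, depending only on $c_1,\dots,c_4$, with the following property. For all $p\ge p_0$, all such $\pi$ and $\theta_\star$ with $\underline\kappa>0$, and all $$n\ge A_1\Big(\frac1{\underline\kappa}\sum_{j=1}^p\bar s_j\Big)^2\log p,$$ 1. $\displaystyle\mathbb E^{(n)}\big[\check\Pi\big(\{\theta:\|\theta_{\cdot j}\|_0>\zeta_j\text{ for some }j\}\mid Z\big)\big]\le e^{-A_2n}+\frac4p$;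 2. $\displaystyle\mathbb E^{(n)}\Big[\check\Pi\Big(\Big\{\theta:\|\theta-\theta_\star\|_F>\frac{M_0}{\underline\kappa_2(\bar s)}\sqrt{\Big(\sum_{j=1}^p\bar s_j\Big)\frac{\log p}n}\Big\}\,\Big|\,Z\Big)\Big]\le2e^{-A_2n}+\frac{12}p$. -/

import Mathlib

open MeasureTheory ProbabilityTheory
open scoped ENNReal Matrix

noncomputable section

namespace IsingQP

/-! ### The Ising model and its column-wise Fisher information -/

/-- The unnormalised weight `exp (∑ⱼ θⱼⱼ xⱼ + ∑_{i<j} θᵢⱼ xᵢ xⱼ)` of `x ∈ {0,1}^p`. -/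
def isingWeight {p : ℕ} (θ : Matrix (Fin p) (Fin p) ℝ) (x : Fin p → Fin 2) : ℝ :=
  Real.exp (∑ j, θ j j * ((x j).val : ℝ) +
    ∑ j, ∑ i with i < j, θ i j * ((x i).val : ℝ) * ((x j).val : ℝ))

/-- The Ising probability mass function `f_θ` on `{0,1}^p`. -/
def isingPMF {p : ℕ} (θ : Matrix (Fin p) (Fin p) ℝ) (x : Fin p → Fin 2) : ℝ :=
  isingWeight θ x / ∑ y, isingWeight θ y

/-- The number of nonzero coordinates `‖u‖₀`. -/
def l0 {p : ℕ} (u : Fin p → ℝ) : ℕ := (Finset.univ.filter fun k => u k ≠ 0).card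

/-- The logistic log-partition function `g(x) = log (1 + eˣ)`. -/
def logPartition (x : ℝ) : ℝ := Real.log (1 + Real.exp x)

/-- The vector `x_(j)`: `x` as a real vector, with its `j`-th coordinate replaced by `1`. -/
def withIntercept {p : ℕ} (j : Fin p) (x : Fin p → Fin 2) : Fin p → ℝ :=
  Function.update (fun k => ((x k).val : ℝ)) j 1

/-- `H^(j) = E[g''(⟨θ_{·j}, X_(j)⟩) X_(j) X_(j)ᵀ]` for `X ∼ f_θ`. -/
def fisher {p : ℕ} (θ : Matrix (Fin p) (Fin p) ℝ) (j : Fin p) : Matrix (Fin p) (Fin p) ℝ :=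
  ∑ x : Fin p → Fin 2,
    (isingPMF θ x * iteratedDeriv 2 logPartition (∑ k, θ k j * withIntercept j x k)) •
      Matrix.vecMulVec (withIntercept j x) (withIntercept j x)

/-- The Rayleigh quotient `uᵀ H^(j) u / ‖u‖₂²`. It is nonnegative because `H^(j)` is positive
semidefinite, so that it is viewed in `[0, ∞]`, where the infimum of the empty set is `∞`. -/
def rayleigh {p : ℕ} (θ : Matrix (Fin p) (Fin p) ℝ) (j : Fin p) (u : Fin p → ℝ) : ℝ≥0∞ :=
  ENNReal.ofReal ((u ⬝ᵥ (fisher θ j *ᵥ u)) / ∑ k, u k ^ 2)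

/-- `κ₂(s)`: the smallest Rayleigh quotient, over all columns, among `s`-sparse vectors. -/
def kappaSparse {p : ℕ} (θ : Matrix (Fin p) (Fin p) ℝ) (s : ℕ) : ℝ≥0∞ :=
  ⨅ (j : Fin p) (u : Fin p → ℝ) (_ : u ≠ 0 ∧ l0 u ≤ s), rayleigh θ j u

/-- `κ₂`: the smallest Rayleigh quotient, over all columns `j`, on the cone of vectors whose
`ℓ¹` norm off the support of `θ_{·j}` is at most `7` times the one on that support. -/
def kappaCone {p : ℕ} (θ : Matrix (Fin p) (Fin p) ℝ) : ℝ≥0∞ :=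
  ⨅ (j : Fin p) (u : Fin p → ℝ)
    (_ : u ≠ 0 ∧ ∑ k with θ k j = 0, |u k| ≤ 7 * ∑ k with θ k j ≠ 0, |u k|), rayleigh θ j u

/-- `s_{⋆j}`: the number of nonzero entries of the `j`-th column. -/
def colSparsity {p : ℕ} (θ : Matrix (Fin p) (Fin p) ℝ) (j : Fin p) : ℕ := l0 fun k => θ k j

/-- The sparsity level `ζ_j` (meaningful when `kappaCone θ > 0`; `4608 / ∞ = 0`). -/
def zeta {p : ℕ} (c₄ : ℝ) (θ : Matrix (Fin p) (Fin p) ℝ) (j : Fin p) : ℝ :=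
  (colSparsity θ j : ℝ) + 4 / c₄ +
    2 / c₄ * (1 + (4608 / kappaCone θ).toReal
      + (colSparsity θ j : ℝ) / (64 * Real.log p ^ 2)
      + Real.log (4 * Real.exp 1) / Real.log p) * (colSparsity θ j : ℝ)

/-- `s̄_j = ⌈s_{⋆j} + ζ_j⌉`. -/
def sbar {p : ℕ} (c₄ : ℝ) (θ : Matrix (Fin p) (Fin p) ℝ) (j : Fin p) : ℕ :=
  ⌈(colSparsity θ j : ℝ) + zeta c₄ θ j⌉₊

/-- `s̄ = max_j s̄_j`. -/
def sbarMax {p : ℕ} (c₄ : ℝ) (θ : Matrix (Fin p) (Fin p) ℝ) : ℕ :=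
  Finset.univ.sup (sbar c₄ θ)

/-- `κ = min (κ₂, κ₂(s̄))`. -/
def kappa {p : ℕ} (c₄ : ℝ) (θ : Matrix (Fin p) (Fin p) ℝ) : ℝ≥0∞ :=
  min (kappaCone θ) (kappaSparse θ (sbarMax c₄ θ))

/-! ### The prior and the quasi-posterior -/

/-- The Borel (product) σ-algebra on real `p × p` matrices. -/
instance matrixMeasurableSpace (p : ℕ) : MeasurableSpace (Matrix (Fin p) (Fin p) ℝ) :=
  inferInstanceAs (MeasurableSpace (Fin p → Fin p → ℝ))

/-- The assumption on the sparsity prior `π` on `{0,1}^p` (an element of `{0,1}^p` is given by the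
set of indices of its ones): `π_δ = g_{|δ|} / (p choose |δ|)` for a probability distribution `g` on
`{0, …, p}` with `c₁ p^{-c₃} g_{s-1} ≤ g_s ≤ c₂ p^{-c₄} g_{s-1}` for `1 ≤ s ≤ p`. -/
def SparsityPrior (c₁ c₂ c₃ c₄ : ℝ) (p : ℕ) (π : Finset (Fin p) → ℝ) : Prop :=
  ∃ g : ℕ → ℝ,
    (∀ s ≤ p, 0 ≤ g s) ∧ ∑ s ∈ Finset.range (p + 1), g s = 1 ∧
    (∀ s, 1 ≤ s → s ≤ p →
      c₁ / (p : ℝ) ^ c₃ * g (s - 1) ≤ g s ∧ g s ≤ c₂ / (p : ℝ) ^ c₄ * g (s - 1)) ∧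
    ∀ δ, π δ = g δ.card / (p.choose δ.card : ℝ)

/-- `μ_{p,δ}`: the product of Lebesgue measures on the coordinates in `δ` and of Dirac masses at
`0` on the others. -/
def slabMeasure {p : ℕ} (δ : Finset (Fin p)) : Measure (Fin p → ℝ) :=
  Measure.pi fun k => if k ∈ δ then (volume : Measure ℝ) else Measure.dirac 0

/-- The prior `∑_δ π_δ (ρ/2)^{|δ|} e^{-ρ‖u‖₁} μ_{p,δ}(du)` of one column. -/
def columnPrior {p : ℕ} (π : Finset (Fin p) → ℝ) (ρ : ℝ) : Measure (Fin p → ℝ) :=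
  ∑ δ : Finset (Fin p), ENNReal.ofReal (π δ) •
    (slabMeasure δ).withDensity fun u =>
      ENNReal.ofReal ((ρ / 2) ^ δ.card * Real.exp (-ρ * ∑ k, |u k|))

/-- The prior on `p × p` matrices with independent columns distributed as `columnPrior`. -/
def matrixPrior {p : ℕ} (π : Finset (Fin p) → ℝ) (ρ : ℝ) :
    Measure (Matrix (Fin p) (Fin p) ℝ) :=
  (Measure.pi fun _ : Fin p => columnPrior π ρ).map fun col => Matrix.of fun k j => col j k

/-- The quasi-likelihood `q_{n,θ}(z)`: the product over the columns `j` of the likelihoods of the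
logistic regressions of the `j`-th column of `z` on the others. -/
def quasiLikelihood {n p : ℕ} (θ : Matrix (Fin p) (Fin p) ℝ) (z : Fin n → Fin p → Fin 2) : ℝ :=
  ∏ j, ∏ i,
    Real.exp (((z i j).val : ℝ) * (θ j j + ∑ k with k ≠ j, θ k j * ((z i k).val : ℝ))) /
      (1 + Real.exp (θ j j + ∑ k with k ≠ j, θ k j * ((z i k).val : ℝ)))

/-- The unnormalised quasi-posterior. -/
def quasiPosteriorUnnorm {n p : ℕ} (π : Finset (Fin p) → ℝ) (ρ : ℝ)
    (z : Fin n → Fin p → Fin 2) : Measure (Matrix (Fin p) (Fin p) ℝ) :=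
  (matrixPrior π ρ).withDensity fun θ => ENNReal.ofReal (quasiLikelihood θ z)

/-- The quasi-posterior distribution on `p × p` matrices given the data `z`. -/
def quasiPosterior {n p : ℕ} (π : Finset (Fin p) → ℝ) (ρ : ℝ)
    (z : Fin n → Fin p → Fin 2) : Measure (Matrix (Fin p) (Fin p) ℝ) :=
  (quasiPosteriorUnnorm π ρ z Set.univ)⁻¹ • quasiPosteriorUnnorm π ρ z

/-- The prior scale `ρ = 24 √(n log p)`. -/
def priorScale (n p : ℕ) : ℝ := 24 * Real.sqrt (n * Real.log p)

/-- The Frobenius norm `√(Tr (AᵀA))`. -/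
def frobNorm {p : ℕ} (A : Matrix (Fin p) (Fin p) ℝ) : ℝ := Real.sqrt (Aᵀ * A).trace

/-- The rows `X i` of the data matrix are independent random vectors in `{0,1}^p` with common
probability mass function `f_θ`. -/
structure IsIsingSample {Ω : Type*} [MeasurableSpace Ω] (P : Measure Ω) {n p : ℕ}
    (θ : Matrix (Fin p) (Fin p) ℝ) (X : Fin n → Ω → Fin p → Fin 2) : Prop where
  measurable : ∀ i, Measurable (X i)
  indep : iIndepFun X P
  law : ∀ i x, P (X i ⁻¹' {x}) = ENNReal.ofReal (isingPMF θ x)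

end IsingQP

end

open IsingQP

/-! The quasi-likelihood is a product over j of the likelihoods of the logistic regressions of
column j on the other columns, and the prior has independent columns. The quasi-posterior therefore
factorises, and the probability of an event about column j is a ratio of two integrals against
`columnPrior` (`quasiPosteriorUnnorm_column`, `quasiPosterior_column_eq`).

Randomness enters only through the event `RegularData`: every score coordinate at the truth is at
most ρ/2, and every entry of the observed information is within r of n times the Fisher information.
The scores are centred because X_j given the other spins is Bernoulli with logistic mean
(`sum_isingPMF_mul_score`), so Hoeffding's inequality and a union bound over p² + p³ entries make
the failure probability at most 1/p. The rest is deterministic.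

Let s be the sparsity of the true column, W its penalised likelihood (`penalizedLik`), and d = u - θ
the error, with ℓ¹ masses B on the true support and C off it. The normalising integral is bounded
below by restricting it to a box of half-width 1/ρ around the true column, on its true support; this
costs W times the prior weight of that support and a factor exp(-(3s/2 + ns²/(2ρ²)))
(`le_penalizedLik`). The numerator is bounded by W exp(E - ρ‖d‖₁/4), where E weighs penalty and
score against curvature (`penalizedLik_le`); integrating the last factor over a slab of dimension t
leaves 4^t (`setLIntegral_columnPrior_le`). W then cancels in `columnMass_div_le`.

Dense columns: off the cone C ≤ 7B the penalty wins, on it the curvature does, so that E ≤ (4608/κ₂)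
s log p (`penalizedLik_le_of_kappaCone`). The geometric decay of the prior beyond `zeta` outweighs
this and the cost of the box (`columnMass_dense_div_le`).

Sparse but distant columns: d has at most `sbar` nonzero entries, so sparse curvature applies and E
is at most -(M/400) `sbar` log p (`penalizedLik_le_of_kappaSparse`). For M large this beats the
prior cost of the true support (`columnMass_far_div_le`).

Each column fails with probability at most p⁻², so a union over the columns and the addition of the
irregular event give 2/p and 3/p, within the claimed bounds. -/

namespace IsingQP

/-! ### The logistic function and logistic log-likelihoods -/

lemma sigmoid_eq_exp_div (a : ℝ) : Real.sigmoid a = Real.exp a / (1 + Real.exp a) := by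
  rw [Real.sigmoid_def, Real.exp_neg]
  have := Real.exp_pos a
  field_simp
  ring

lemma hasDerivAt_logPartition (a : ℝ) : HasDerivAt logPartition (Real.sigmoid a) a := by
  have h : (1 : ℝ) + Real.exp a ≠ 0 := by positivity
  have := ((Real.hasDerivAt_exp a).const_add 1).log h
  rw [← sigmoid_eq_exp_div] at this
  exact this

lemma iteratedDeriv_two_logPartition (a : ℝ) :
    iteratedDeriv 2 logPartition a = Real.sigmoid a * (1 - Real.sigmoid a) := by
  have h : deriv logPartition = Real.sigmoid := funext fun x => (hasDerivAt_logPartition x).deriv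
  rw [iteratedDeriv_succ, iteratedDeriv_one, h, Real.deriv_sigmoid]

lemma sigmoid_variance_nonneg (a : ℝ) : 0 ≤ Real.sigmoid a * (1 - Real.sigmoid a) :=
  mul_nonneg (Real.sigmoid_nonneg a) (sub_nonneg.2 (Real.sigmoid_le_one a))

lemma sigmoid_variance_le_one (a : ℝ) : Real.sigmoid a * (1 - Real.sigmoid a) ≤ 1 := by
  nlinarith [Real.sigmoid_nonneg a, Real.sigmoid_le_one a]

lemma logPartition_neg (a : ℝ) : logPartition (-a) = logPartition a - a := by
  have h : 1 + Real.exp a = (1 + Real.exp (-a)) * Real.exp a := by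
    rw [Real.exp_neg]
    field_simp
    ring
  rw [logPartition, logPartition, h, Real.log_mul (by positivity) (by positivity), Real.log_exp]
  ring

lemma sigmoid_add_sub_le (a h : ℝ) (hh : 0 ≤ h) :
    Real.sigmoid (a + h) - Real.sigmoid a ≤ h := by
  rw [sigmoid_eq_exp_div, sigmoid_eq_exp_div, Real.exp_add]
  have hE := Real.exp_pos a
  have hH : 1 ≤ Real.exp h := Real.one_le_exp hh
  have hh1 : 1 - h ≤ (Real.exp h)⁻¹ := by
    rw [← Real.exp_neg]; linarith [Real.add_one_le_exp (-h)]
  set E := Real.exp a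
  set H := Real.exp h
  have h1 : E * H / (1 + E * H) - E / (1 + E) ≤ 1 - H⁻¹ := by
    rw [div_sub_div _ _ (by positivity) (by positivity)]
    have : 1 - H⁻¹ = (H - 1) / H := by field_simp
    rw [this, div_le_div_iff₀ (by positivity) (by positivity)]
    have : 0 ≤ (H - 1) * (1 + E + E * E * H) := mul_nonneg (by linarith) (by positivity)
    nlinarith
  linarith

/-- A self-concordance estimate: with E = exp a and H = exp h, both sides are E(H - 1) over a
denominator, and 1 + EH ≤ H(1 + E) compares the denominators. -/
lemma le_sigmoid_add_sub (a h : ℝ) (hh : 0 ≤ h) :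
    Real.sigmoid a * (1 - Real.sigmoid a) * (1 - Real.exp (-h)) ≤
      Real.sigmoid (a + h) - Real.sigmoid a := by
  rw [sigmoid_eq_exp_div, sigmoid_eq_exp_div, Real.exp_add, Real.exp_neg]
  have hE := Real.exp_pos a
  have hH : 1 ≤ Real.exp h := Real.one_le_exp hh
  set E := Real.exp a
  set H := Real.exp h
  have e1 : E / (1 + E) * (1 - E / (1 + E)) * (1 - H⁻¹) =
      (E * (H - 1)) * (1 / ((1 + E) * (H * (1 + E)))) := by
    field_simp; ring
  have e2 : E * H / (1 + E * H) - E / (1 + E) =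
      (E * (H - 1)) * (1 / ((1 + E) * (1 + E * H))) := by
    field_simp; ring
  rw [e1, e2]
  apply mul_le_mul_of_nonneg_left _ (mul_nonneg hE.le (by linarith))
  apply one_div_le_one_div_of_le (by positivity)
  apply mul_le_mul_of_nonneg_left _ (by positivity)
  nlinarith

lemma nonneg_of_hasDerivAt_nonneg {f f' : ℝ → ℝ} (hf : ∀ x, HasDerivAt f (f' x) x)
    (h0 : f 0 = 0) (hf' : ∀ x, 0 ≤ x → 0 ≤ f' x) {x : ℝ} (hx : 0 ≤ x) : 0 ≤ f x := by
  have := monotoneOn_of_deriv_nonneg (convex_Ici 0)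
    (fun y _ => (hf y).continuousAt.continuousWithinAt)
    (fun y _ => (hf y).differentiableAt.differentiableWithinAt)
    (fun y hy => by
      rw [(hf y).deriv]
      exact hf' y (interior_subset hy))
  simpa [h0] using this (Set.mem_Ici.2 le_rfl) (Set.mem_Ici.2 hx) hx

/-- The logistic function is 1-Lipschitz; this is integrated once in h. -/
lemma logPartition_bregman_le (a h : ℝ) :
    logPartition (a + h) - logPartition a - Real.sigmoid a * h ≤ h ^ 2 / 2 := by
  have key : ∀ a h : ℝ, 0 ≤ h →
      logPartition (a + h) - logPartition a - Real.sigmoid a * h ≤ h ^ 2 / 2 := by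
    intro a h hh
    have := nonneg_of_hasDerivAt_nonneg
      (f := fun h => h ^ 2 / 2 - (logPartition (a + h) - logPartition a - Real.sigmoid a * h))
      (f' := fun h => h - (Real.sigmoid (a + h) - Real.sigmoid a))
      (fun x => by
        have h1 := ((hasDerivAt_logPartition (a + x)).comp_const_add a x).sub_const (logPartition a)
        have h2 := (hasDerivAt_id x).const_mul (Real.sigmoid a)
        have h3 := ((hasDerivAt_id x).pow 2).div_const 2
        exact (h3.sub (h1.sub h2)).congr_deriv (by simp))
      (by simp) (fun x hx => by linarith [sigmoid_add_sub_le a x hx]) hh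
    simpa using this
  rcases le_total 0 h with hh | hh
  · exact key a h hh
  -- Negative increments follow by the reflection a ↦ -a, under which the Bregman divergence is
  -- invariant.
  · have := key (-a) (-h) (by linarith)
    rw [← neg_add, logPartition_neg, logPartition_neg, Real.sigmoid_neg] at this
    nlinarith

lemma sq_div_two_add_le (h : ℝ) (hh : 0 ≤ h) :
    h ^ 2 / (2 + h) ≤ Real.exp (-h) - 1 + h := by
  have h0 : 0 ≤ 2 + h - Real.exp h * (2 - h) :=
    nonneg_of_hasDerivAt_nonneg (f := fun h => 2 + h - Real.exp h * (2 - h))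
      (f' := fun h => 1 - Real.exp h * (1 - h))
      (fun x => by
        have h1 := (hasDerivAt_id x).const_add 2
        have h2 := (Real.hasDerivAt_exp x).mul ((hasDerivAt_id x).const_sub 2)
        exact (h1.sub h2).congr_deriv (by simp; ring))
      (by simp)
      (fun x _ => by
        have h1 : Real.exp x * (1 - x) ≤ Real.exp x * Real.exp (-x) :=
          mul_le_mul_of_nonneg_left (by linarith [Real.add_one_le_exp (-x)]) (Real.exp_pos x).le
        rw [← Real.exp_add] at h1
        simp at h1
        linarith) hh
  rw [Real.exp_neg, div_le_iff₀ (by linarith)]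
  have hE := Real.exp_pos h
  have h1 : (2 - h) ≤ (Real.exp h)⁻¹ * (2 + h) := by
    rw [inv_mul_eq_div, le_div_iff₀ hE]
    linarith
  nlinarith

/-- Integrating `le_sigmoid_add_sub` gives σ'(a)(exp(-h) - 1 + h), a curvature bound in terms of σ'
at the base point only. It is quadratic for small h and linear for large h, hence the denominator 2
+ |h|, which later becomes 2 + ‖u - v‖₁. -/
lemma le_logPartition_bregman (a h : ℝ) :
    Real.sigmoid a * (1 - Real.sigmoid a) * (h ^ 2 / (2 + |h|)) ≤
      logPartition (a + h) - logPartition a - Real.sigmoid a * h := by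
  have key : ∀ a h : ℝ, 0 ≤ h → Real.sigmoid a * (1 - Real.sigmoid a) * (h ^ 2 / (2 + h)) ≤
      logPartition (a + h) - logPartition a - Real.sigmoid a * h := by
    intro a h hh
    have := nonneg_of_hasDerivAt_nonneg
      (f := fun h => (logPartition (a + h) - logPartition a - Real.sigmoid a * h) -
        Real.sigmoid a * (1 - Real.sigmoid a) * (Real.exp (-h) - 1 + h))
      (f' := fun h => (Real.sigmoid (a + h) - Real.sigmoid a) -
        Real.sigmoid a * (1 - Real.sigmoid a) * (1 - Real.exp (-h)))
      (fun x => by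
        have h1 := ((hasDerivAt_logPartition (a + x)).comp_const_add a x).sub_const (logPartition a)
        have h2 := (hasDerivAt_id x).const_mul (Real.sigmoid a)
        have h3 := ((((hasDerivAt_neg x).exp).sub_const 1).add (hasDerivAt_id x)).const_mul
          (Real.sigmoid a * (1 - Real.sigmoid a))
        exact ((h1.sub h2).sub h3).congr_deriv (by ring))
      (by simp) (fun x hx => by linarith [le_sigmoid_add_sub a x hx]) hh
    have h2 := mul_le_mul_of_nonneg_left (sq_div_two_add_le h hh) (sigmoid_variance_nonneg a)
    linarith
  rcases le_total 0 h with hh | hh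
  · rw [abs_of_nonneg hh]; exact key a h hh
  · have := key (-a) (-h) (by linarith)
    rw [← neg_add, logPartition_neg, logPartition_neg, Real.sigmoid_neg] at this
    rw [abs_of_nonpos hh]
    have e : (1 - Real.sigmoid a) * (1 - (1 - Real.sigmoid a)) =
      Real.sigmoid a * (1 - Real.sigmoid a) := by ring
    rw [e, neg_sq] at this
    linarith

/-! ### Second-order bounds for the logistic log-likelihood. -/

section LogLik

variable {n p : ℕ}

/-- The log-likelihood at `u` of the logistic regression of `y` on the covariates `x`. -/
noncomputable def logisticLogLik (x : Fin n → Fin p → ℝ) (y : Fin n → ℝ) (u : Fin p → ℝ) : ℝ :=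
  ∑ i, (y i * ∑ k, u k * x i k - logPartition (∑ k, u k * x i k))

/-- The `k`-th partial derivative at `v` of `logisticLogLik`. -/
noncomputable def logisticScore (x : Fin n → Fin p → ℝ) (y : Fin n → ℝ) (v : Fin p → ℝ)
    (k : Fin p) : ℝ :=
  ∑ i, (y i - Real.sigmoid (∑ l, v l * x i l)) * x i k

/-- The observed information at `v`, minus the Hessian of `logisticLogLik`. -/
noncomputable def logisticInfo (x : Fin n → Fin p → ℝ) (v : Fin p → ℝ) (k l : Fin p) : ℝ :=
  ∑ i, Real.sigmoid (∑ m, v m * x i m) * (1 - Real.sigmoid (∑ m, v m * x i m)) * x i k * x i l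

/-- The response enters linearly, so after the score term the exact remainder is a sum of Bregman
divergences of `logPartition`, free of y. -/
lemma logisticLogLik_sub (x : Fin n → Fin p → ℝ) (y : Fin n → ℝ) (u v : Fin p → ℝ) :
    logisticLogLik x y u - logisticLogLik x y v =
      ∑ k, logisticScore x y v k * (u k - v k) -
      ∑ i, (logPartition (∑ k, v k * x i k + ∑ k, (u k - v k) * x i k) -
        logPartition (∑ k, v k * x i k) -
        Real.sigmoid (∑ k, v k * x i k) * ∑ k, (u k - v k) * x i k) := by
  have h1 : ∑ k, logisticScore x y v k * (u k - v k) =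
      ∑ i, (y i - Real.sigmoid (∑ l, v l * x i l)) * ∑ k, (u k - v k) * x i k := by
    simp only [logisticScore, Finset.sum_mul, Finset.mul_sum]
    rw [Finset.sum_comm]
    exact Finset.sum_congr rfl fun i _ => Finset.sum_congr rfl fun k _ => by ring
  rw [h1, logisticLogLik, logisticLogLik, ← Finset.sum_sub_distrib, ← Finset.sum_sub_distrib]
  refine Finset.sum_congr rfl fun i _ => ?_
  have h2 : ∑ k, (u k - v k) * x i k = ∑ k, u k * x i k - ∑ k, v k * x i k := by
    rw [← Finset.sum_sub_distrib]
    exact Finset.sum_congr rfl fun k _ => by ring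
  rw [h2, add_sub_cancel]
  ring

lemma abs_sum_mul_le_of_abs_le {R : ℝ} {a d : Fin p → ℝ} (h : ∀ k, |a k| ≤ R) :
    |∑ k, a k * d k| ≤ R * ∑ k, |d k| := by
  rw [Finset.mul_sum]
  refine (Finset.abs_sum_le_sum_abs _ _).trans (Finset.sum_le_sum fun k _ => ?_)
  rw [abs_mul]
  exact mul_le_mul_of_nonneg_right (h k) (abs_nonneg _)

lemma abs_sum_mul_le_of_abs_le_one {a d : Fin p → ℝ} (h : ∀ k, |a k| ≤ 1) :
    |∑ k, d k * a k| ≤ ∑ k, |d k| := by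
  simpa [mul_comm] using abs_sum_mul_le_of_abs_le (d := d) h

lemma le_logisticLogLik {x : Fin n → Fin p → ℝ} {y : Fin n → ℝ} {u v : Fin p → ℝ} {R : ℝ}
    (hx : ∀ i k, |x i k| ≤ 1) (hR : ∀ k, |logisticScore x y v k| ≤ R) :
    logisticLogLik x y v - R * ∑ k, |u k - v k| - n * (∑ k, |u k - v k|) ^ 2 / 2 ≤
      logisticLogLik x y u := by
  have h := logisticLogLik_sub x y u v
  have h1 := (abs_le.1 (abs_sum_mul_le_of_abs_le (d := fun k => u k - v k) hR)).1
  have h2 : ∑ i, (logPartition (∑ k, v k * x i k + ∑ k, (u k - v k) * x i k) -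
        logPartition (∑ k, v k * x i k) -
        Real.sigmoid (∑ k, v k * x i k) * ∑ k, (u k - v k) * x i k) ≤
      ∑ _i : Fin n, (∑ k, |u k - v k|) ^ 2 / 2 := by
    refine Finset.sum_le_sum fun i _ => (logPartition_bregman_le _ _).trans ?_
    have := abs_sum_mul_le_of_abs_le_one (d := fun k => u k - v k) (hx i)
    have := sq_le_sq' (abs_le.1 this).1 (abs_le.1 this).2
    linarith
  simp only [Finset.sum_const, Finset.card_univ, Fintype.card_fin, nsmul_eq_mul] at h2
  linarith

lemma sum_sigmoid_variance_mul_sq (x : Fin n → Fin p → ℝ) (v d : Fin p → ℝ) :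
    ∑ i, Real.sigmoid (∑ m, v m * x i m) * (1 - Real.sigmoid (∑ m, v m * x i m)) *
      (∑ k, d k * x i k) ^ 2 = ∑ k, ∑ l, logisticInfo x v k l * (d k * d l) := by
  simp only [logisticInfo, Finset.sum_mul, sq, Finset.mul_sum]
  rw [Finset.sum_comm]
  simp_rw [Finset.sum_comm (s := (Finset.univ : Finset (Fin n)))]
  rw [Finset.sum_comm]
  exact Finset.sum_congr rfl fun k _ => Finset.sum_congr rfl fun l _ =>
    Finset.sum_congr rfl fun i _ => by ring

lemma logisticLogLik_le {x : Fin n → Fin p → ℝ} {y : Fin n → ℝ} {u v : Fin p → ℝ} {R : ℝ}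
    (hx : ∀ i k, |x i k| ≤ 1) (hR : ∀ k, |logisticScore x y v k| ≤ R) :
    logisticLogLik x y u ≤ logisticLogLik x y v + R * ∑ k, |u k - v k| -
      (∑ k, ∑ l, logisticInfo x v k l * ((u k - v k) * (u l - v l))) /
        (2 + ∑ k, |u k - v k|) := by
  have h := logisticLogLik_sub x y u v
  have h1 := (abs_le.1 (abs_sum_mul_le_of_abs_le (d := fun k => u k - v k) hR)).2
  have hs : 0 ≤ ∑ k, |u k - v k| := Finset.sum_nonneg fun _ _ => abs_nonneg _
  have h2 : (∑ k, ∑ l, logisticInfo x v k l * ((u k - v k) * (u l - v l))) /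
        (2 + ∑ k, |u k - v k|) ≤
      ∑ i, (logPartition (∑ k, v k * x i k + ∑ k, (u k - v k) * x i k) -
        logPartition (∑ k, v k * x i k) -
        Real.sigmoid (∑ k, v k * x i k) * ∑ k, (u k - v k) * x i k) := by
    rw [← sum_sigmoid_variance_mul_sq x v (fun k => u k - v k), Finset.sum_div]
    refine Finset.sum_le_sum fun i _ => le_trans ?_ (le_logPartition_bregman _ _)
    rw [mul_div_assoc]
    refine mul_le_mul_of_nonneg_left ?_ (sigmoid_variance_nonneg _)
    have := abs_sum_mul_le_of_abs_le_one (d := fun k => u k - v k) (hx i)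
    exact div_le_div_of_nonneg_left (sq_nonneg _) (by positivity) (by linarith)
  linarith

end LogLik

/-! ### Integrals against the column prior -/

lemma lintegral_fin_prod_eq_prod {n : ℕ} {E : Type*} [MeasurableSpace E] (μ : Fin n → Measure E)
    [∀ i, SigmaFinite (μ i)] {f : Fin n → E → ℝ≥0∞} (hf : ∀ i, Measurable (f i)) :
    ∫⁻ x, ∏ i, f i (x i) ∂(Measure.pi μ) = ∏ i, ∫⁻ x, f i x ∂(μ i) := by
  induction n with
  | zero => simp
  | succ n ih =>
    rw [← ((measurePreserving_piFinSuccAbove μ 0).symm).lintegral_comp_emb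
      (MeasurableEquiv.measurableEmbedding _)]
    simp_rw [MeasurableEquiv.piFinSuccAbove_symm_apply, Fin.insertNthEquiv,
      Fin.prod_univ_succ, Fin.insertNth_zero]
    simp only [Equiv.coe_fn_mk, Fin.cons_zero, Fin.cons_succ, Fin.zero_succAbove, cast_eq]
    rw [lintegral_prod_mul (f := f 0) (g := fun y : Fin n → E => ∏ i : Fin n, f i.succ (y i))
      (hf 0).aemeasurable
      (Finset.measurable_prod _ fun i _ => (hf _).comp (measurable_pi_apply i)).aemeasurable,
      ih _ fun i => hf i.succ]

lemma lintegral_exp_neg_mul_abs_sub {c : ℝ} (hc : 0 < c) (a : ℝ) :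
    ∫⁻ x : ℝ, ENNReal.ofReal (Real.exp (-(c * |x - a|))) = ENNReal.ofReal (2 / c) := by
  rw [lintegral_sub_right_eq_self (fun x : ℝ => ENNReal.ofReal (Real.exp (-(c * |x|)))) a]
  have h : ∫ x : ℝ, Real.exp (-(c * |x|)) = 2 / c := by
    rw [integral_comp_abs (f := fun x => Real.exp (-(c * x)))]
    have := integral_exp_mul_Ioi (a := -c) (by linarith) 0
    simp only [neg_mul] at this
    rw [this]
    simp
    ring
  rw [← h, ofReal_integral_eq_lintegral_ofReal]
  · refine Integrable.of_integral_ne_zero ?_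
    rw [h]
    positivity
  · exact Filter.Eventually.of_forall fun x => (Real.exp_pos _).le

variable {n p : ℕ}

instance slabFactor_sigmaFinite (δ : Finset (Fin p)) (k : Fin p) :
    SigmaFinite (if k ∈ δ then (volume : Measure ℝ) else Measure.dirac 0) := by
  split_ifs <;> infer_instance

lemma prod_ite_mem_eq_pow (δ : Finset (Fin p)) (c : ℝ≥0∞) :
    ∏ k, (if k ∈ δ then c else 1) = c ^ δ.card := by
  simp

/-- A Lebesgue coordinate integrates to 2/c; a Dirac coordinate contributes exp(-c|v k|) ≤ 1. -/
lemma lintegral_slabMeasure_exp_le {c : ℝ} (hc : 0 < c) (δ : Finset (Fin p)) (v : Fin p → ℝ) :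
    ∫⁻ u, ENNReal.ofReal (Real.exp (-(c * ∑ k, |u k - v k|))) ∂slabMeasure δ ≤
      ENNReal.ofReal (2 / c) ^ δ.card := by
  have h : ∀ u : Fin p → ℝ, ENNReal.ofReal (Real.exp (-(c * ∑ k, |u k - v k|))) =
      ∏ k, ENNReal.ofReal (Real.exp (-(c * |u k - v k|))) := by
    intro u
    rw [Finset.mul_sum, ← Finset.sum_neg_distrib, Real.exp_sum,
      ENNReal.ofReal_prod_of_nonneg fun _ _ => (Real.exp_pos _).le]
  simp_rw [h]
  rw [slabMeasure, lintegral_fin_prod_eq_prod _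
    (f := fun k x => ENNReal.ofReal (Real.exp (-(c * |x - v k|)))) fun k => by fun_prop,
    ← prod_ite_mem_eq_pow]
  refine Finset.prod_le_prod' fun k _ => ?_
  split_ifs with hk
  · exact (lintegral_exp_neg_mul_abs_sub hc _).le
  · rw [lintegral_dirac' _ (by fun_prop)]
    refine ENNReal.ofReal_le_one.2 (Real.exp_le_one_iff.2 ?_)
    have := mul_nonneg hc.le (abs_nonneg (0 - v k))
    linarith

lemma ae_slabMeasure_eq_zero (δ : Finset (Fin p)) :
    ∀ᵐ u ∂slabMeasure δ, ∀ k, k ∉ δ → u k = 0 := by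
  rw [ae_all_iff]
  intro k
  by_cases hk : k ∈ δ
  · simp [hk]
  · have h : ∀ᵐ x ∂(if k ∈ δ then (volume : Measure ℝ) else Measure.dirac 0), x = 0 := by
      simp [hk, ae_dirac_eq]
    filter_upwards [(Measure.quasiMeasurePreserving_eval
      (fun k => if k ∈ δ then (volume : Measure ℝ) else Measure.dirac 0) k).ae h] with u hu _
    exact hu

lemma l0_le_card {δ : Finset (Fin p)} {u : Fin p → ℝ} (h : ∀ k, k ∉ δ → u k = 0) :
    l0 u ≤ δ.card :=
  Finset.card_le_card fun k hk => by
    by_contra hk'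
    exact (Finset.mem_filter.1 hk).2 (h k hk')

lemma slabMeasure_lt_l0 {δ : Finset (Fin p)} {a : ℝ} (h : (δ.card : ℝ) ≤ a) :
    slabMeasure δ {u | a < l0 u} = 0 := by
  refine measure_mono_null (t := {u | ¬ ∀ k, k ∉ δ → u k = 0}) ?_
    (ae_iff.1 (ae_slabMeasure_eq_zero δ))
  intro u hu hu'
  have h1 : (l0 u : ℝ) ≤ δ.card := by exact_mod_cast l0_le_card hu'
  have h2 : a < l0 u := hu
  linarith

lemma lintegral_columnPrior (π : Finset (Fin p) → ℝ) (ρ : ℝ) {f : (Fin p → ℝ) → ℝ≥0∞}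
    (hf : Measurable f) :
    ∫⁻ u, f u ∂columnPrior π ρ = ∑ δ, ENNReal.ofReal (π δ) * ∫⁻ u,
      ENNReal.ofReal ((ρ / 2) ^ δ.card * Real.exp (-ρ * ∑ k, |u k|)) * f u ∂slabMeasure δ := by
  rw [columnPrior, lintegral_finsetSum_measure]
  refine Finset.sum_congr rfl fun δ _ => ?_
  rw [lintegral_smul_measure, lintegral_withDensity_eq_lintegral_mul _ (by fun_prop) hf]
  rfl

/-- Numerator bound. A quarter of the penalty, recentred at v, suffices for integrability: its slab
integral (8/ρ)^t times the prior normalisation (ρ/2)^t is 4^t. Only supports in A can charge B. -/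
lemma setLIntegral_columnPrior_le {π : Finset (Fin p) → ℝ} (hπ : ∀ δ, 0 ≤ π δ) {ρ : ℝ}
    (hρ : 0 < ρ) {F : (Fin p → ℝ) → ℝ} (hF : Measurable F) {B : Set (Fin p → ℝ)}
    (hB : MeasurableSet B) {K : ℝ} (hK : 0 ≤ K) (v : Fin p → ℝ)
    (h : ∀ u ∈ B, F u * Real.exp (-ρ * ∑ k, |u k|) ≤
      K * Real.exp (-(ρ / 4 * ∑ k, |u k - v k|)))
    (A : Finset (Finset (Fin p))) (hA : ∀ δ, δ ∉ A → slabMeasure δ B = 0) :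
    ∫⁻ u in B, ENNReal.ofReal (F u) ∂columnPrior π ρ ≤
      ENNReal.ofReal (K * ∑ δ ∈ A, π δ * 4 ^ δ.card) := by
  rw [← lintegral_indicator hB, lintegral_columnPrior _ _ (hF.ennreal_ofReal.indicator hB),
    ← Finset.sum_subset (Finset.subset_univ A), Finset.mul_sum, ENNReal.ofReal_sum_of_nonneg]
  · refine Finset.sum_le_sum fun δ _ => ?_
    have h1 : ∫⁻ u, ENNReal.ofReal ((ρ / 2) ^ δ.card * Real.exp (-ρ * ∑ k, |u k|)) *
        B.indicator (fun u => ENNReal.ofReal (F u)) u ∂slabMeasure δ ≤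
        ∫⁻ u, ENNReal.ofReal ((ρ / 2) ^ δ.card * K) *
          ENNReal.ofReal (Real.exp (-(ρ / 4 * ∑ k, |u k - v k|))) ∂slabMeasure δ := by
      refine lintegral_mono fun u => ?_
      by_cases hu : u ∈ B
      · rw [Set.indicator_of_mem hu, ← ENNReal.ofReal_mul (by positivity),
          ← ENNReal.ofReal_mul (by positivity)]
        refine ENNReal.ofReal_le_ofReal ?_
        have := mul_le_mul_of_nonneg_left (h u hu) (by positivity : 0 ≤ (ρ / 2) ^ δ.card)
        linarith
      · simp [Set.indicator_of_notMem hu]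
    rw [lintegral_const_mul _ (by fun_prop)] at h1
    have h2 := h1.trans (mul_le_mul_right (lintegral_slabMeasure_exp_le
      (by positivity : 0 < ρ / 4) δ v) _)
    rw [← ENNReal.ofReal_pow (by positivity), ← ENNReal.ofReal_mul (by positivity)] at h2
    have h3 : (ρ / 2) ^ δ.card * K * (2 / (ρ / 4)) ^ δ.card = K * 4 ^ δ.card := by
      rw [mul_right_comm, ← mul_pow]
      have : ρ / 2 * (2 / (ρ / 4)) = 4 := by field_simp
      rw [this, mul_comm]
    rw [h3] at h2
    refine (mul_le_mul_right h2 _).trans ?_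
    rw [← ENNReal.ofReal_mul (hπ δ)]
    exact ENNReal.ofReal_le_ofReal (le_of_eq (by ring))
  · intro δ _
    have := hπ δ
    positivity
  · intro δ _ hδ
    have h0 : ∀ᵐ u ∂slabMeasure δ, u ∉ B := measure_eq_zero_iff_ae_notMem.1 (hA δ hδ)
    rw [lintegral_congr_ae (g := fun _ => 0), lintegral_zero, mul_zero]
    filter_upwards [h0] with u hu
    simp [Set.indicator_of_notMem hu]

/-- Denominator bound. Only the slab on S is kept, restricted to a box with sides 2/ρ, whose volume
exactly cancels (ρ/2)^|S|. -/
lemma le_lintegral_columnPrior {π : Finset (Fin p) → ℝ} {ρ : ℝ}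
    (hρ : 0 < ρ) {F : (Fin p → ℝ) → ℝ} (hF : Measurable F) {c : ℝ}
    {v : Fin p → ℝ} {S : Finset (Fin p)} (hS : ∀ k, k ∉ S → v k = 0)
    (h : ∀ u, (∀ k, k ∉ S → u k = 0) → (∀ k, |u k - v k| ≤ 1 / ρ) →
      c ≤ F u * Real.exp (-ρ * ∑ k, |u k|)) :
    ENNReal.ofReal (π S) * ENNReal.ofReal c ≤
      ∫⁻ u, ENNReal.ofReal (F u) ∂columnPrior π ρ := by
  rw [lintegral_columnPrior _ _ hF.ennreal_ofReal]
  refine le_trans ?_ (Finset.single_le_sum (f := fun δ => ENNReal.ofReal (π δ) * ∫⁻ u,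
      ENNReal.ofReal ((ρ / 2) ^ δ.card * Real.exp (-ρ * ∑ k, |u k|)) *
        ENNReal.ofReal (F u) ∂slabMeasure δ) (fun _ _ => zero_le) (Finset.mem_univ S))
  refine mul_le_mul_right ?_ _
  set box : Set (Fin p → ℝ) :=
    Set.univ.pi fun k => if k ∈ S then Set.Icc (v k - 1 / ρ) (v k + 1 / ρ) else {0}
  have hbox : slabMeasure S box = ENNReal.ofReal (2 / ρ) ^ S.card := by
    rw [slabMeasure, Measure.pi_pi, ← prod_ite_mem_eq_pow]
    refine Finset.prod_congr rfl fun k _ => ?_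
    split_ifs
    · rw [Real.volume_Icc]
      congr 1
      ring
    · simp
  have hboxm : MeasurableSet box := by
    refine MeasurableSet.univ_pi fun k => ?_
    split_ifs
    · exact measurableSet_Icc
    · exact measurableSet_singleton 0
  have hpt : ∀ u ∈ box, ENNReal.ofReal ((ρ / 2) ^ S.card) * ENNReal.ofReal c ≤
      ENNReal.ofReal ((ρ / 2) ^ S.card * Real.exp (-ρ * ∑ k, |u k|)) * ENNReal.ofReal (F u) := by
    intro u hu
    have h0 : ∀ k, k ∉ S → u k = 0 := by
      intro k hk
      simpa [hk] using hu k (Set.mem_univ k)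
    have h1 : ∀ k, |u k - v k| ≤ 1 / ρ := by
      intro k
      by_cases hk : k ∈ S
      · have := hu k (Set.mem_univ k)
        simp only [hk, if_true] at this
        rw [abs_le]
        constructor <;> linarith [this.1, this.2]
      · rw [h0 k hk, hS k hk]
        simp only [sub_self, abs_zero]
        positivity
    rw [← ENNReal.ofReal_mul (by positivity), ← ENNReal.ofReal_mul (by positivity)]
    refine ENNReal.ofReal_le_ofReal ?_
    rw [mul_assoc]
    refine mul_le_mul_of_nonneg_left ?_ (by positivity)
    rw [mul_comm]
    exact h u h0 h1
  calc ENNReal.ofReal c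
      = ∫⁻ _ in box, ENNReal.ofReal ((ρ / 2) ^ S.card) * ENNReal.ofReal c ∂slabMeasure S := by
        rw [setLIntegral_const, hbox, mul_right_comm, ← ENNReal.ofReal_pow (by positivity),
          ← ENNReal.ofReal_mul (by positivity), ← mul_pow]
        have : ρ / 2 * (2 / ρ) = 1 := by field_simp
        simp [this]
    _ ≤ ∫⁻ u in box, ENNReal.ofReal ((ρ / 2) ^ S.card * Real.exp (-ρ * ∑ k, |u k|)) *
          ENNReal.ofReal (F u) ∂slabMeasure S := setLIntegral_mono' hboxm hpt
    _ ≤ _ := setLIntegral_le_lintegral _ _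

/-- Sums of functions of the cardinality against the prior weights. -/
lemma sum_prior_card {π : Finset (Fin p) → ℝ} {g : ℕ → ℝ}
    (hπ : ∀ δ, π δ = g δ.card / (p.choose δ.card : ℝ)) (P : ℕ → Prop) [DecidablePred P] :
    ∑ δ : Finset (Fin p) with P δ.card, π δ * 4 ^ δ.card =
      ∑ t ∈ (Finset.range (p + 1)).filter P, g t * 4 ^ t := by
  rw [Finset.sum_filter, Finset.sum_filter]
  have := Finset.sum_powerset_apply_card
    (f := fun t => if P t then g t / (p.choose t : ℝ) * (4 : ℝ) ^ t else 0)
    (x := (Finset.univ : Finset (Fin p)))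
  simp only [Finset.powerset_univ, Finset.card_univ, Fintype.card_fin] at this
  simp_rw [hπ]
  rw [this]
  refine Finset.sum_congr rfl fun t ht => ?_
  have hc : (p.choose t : ℝ) ≠ 0 := by
    exact_mod_cast (Nat.choose_pos (Nat.lt_succ_iff.1 (Finset.mem_range.1 ht))).ne'
  split_ifs
  · rw [nsmul_eq_mul]
    field_simp
  · simp

/-! ### The quasi-posterior is a product over the columns -/

/-- The covariates of the logistic regression of the `j`-th column of `z` on the others. -/
noncomputable def covariates (z : Fin n → Fin p → Fin 2) (j : Fin p) : Fin n → Fin p → ℝ :=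
  fun i => withIntercept j (z i)

/-- The response of the logistic regression of the `j`-th column of `z` on the others. -/
noncomputable def response (z : Fin n → Fin p → Fin 2) (j : Fin p) : Fin n → ℝ :=
  fun i => ((z i j).val : ℝ)

/-- The likelihood of the logistic regression of the `j`-th column of `z` on the others. -/
noncomputable def columnLik (z : Fin n → Fin p → Fin 2) (j : Fin p) (u : Fin p → ℝ) : ℝ :=
  Real.exp (logisticLogLik (covariates z j) (response z j) u)

lemma sum_mul_withIntercept (u : Fin p → ℝ) (j : Fin p) (x : Fin p → Fin 2) :
    ∑ k, u k * withIntercept j x k = u j + ∑ k with k ≠ j, u k * ((x k).val : ℝ) := by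
  rw [← Finset.add_sum_erase _ _ (Finset.mem_univ j), withIntercept, Function.update_self, mul_one]
  congr 1
  have : Finset.univ.erase j = Finset.univ.filter fun k => k ≠ j := by
    ext k; simp
  rw [this]
  refine Finset.sum_congr rfl fun k hk => ?_
  rw [Function.update_of_ne (Finset.mem_filter.1 hk).2]

lemma quasiLikelihood_eq_prod (θ : Matrix (Fin p) (Fin p) ℝ) (z : Fin n → Fin p → Fin 2) :
    quasiLikelihood θ z = ∏ j, columnLik z j fun k => θ k j := by
  refine Finset.prod_congr rfl fun j _ => ?_
  rw [columnLik, logisticLogLik, Real.exp_sum]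
  refine Finset.prod_congr rfl fun i _ => ?_
  rw [Real.exp_sub, logPartition, Real.exp_log (by positivity), covariates,
    sum_mul_withIntercept (fun k => θ k j), response]

lemma measurable_columnLik (z : Fin n → Fin p → Fin 2) (j : Fin p) :
    Measurable (columnLik z j) := by
  unfold columnLik logisticLogLik logPartition
  fun_prop

lemma columnLik_pos (z : Fin n → Fin p → Fin 2) (j : Fin p) (u : Fin p → ℝ) :
    0 < columnLik z j u := Real.exp_pos _

lemma fin_two_val_cast_cases (b : Fin 2) : ((b.val : ℕ) : ℝ) = 0 ∨ ((b.val : ℕ) : ℝ) = 1 := by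
  have := b.isLt
  interval_cases b.val <;> simp

lemma columnLik_le_one (z : Fin n → Fin p → Fin 2) (j : Fin p) (u : Fin p → ℝ) :
    columnLik z j u ≤ 1 := by
  refine Real.exp_le_one_iff.2 (Finset.sum_nonpos fun i _ => ?_)
  set a := ∑ k, u k * covariates z j i k
  have h1 : 0 ≤ logPartition a := Real.log_nonneg (by linarith [Real.exp_pos a])
  have h2 : a ≤ logPartition a := by
    rw [logPartition, Real.le_log_iff_exp_le (by positivity)]
    linarith
  rcases fin_two_val_cast_cases (z i j) with h | h <;> rw [response, h] <;> linarith

lemma abs_withIntercept_le_one (j : Fin p) (x : Fin p → Fin 2) (k : Fin p) :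
    |withIntercept j x k| ≤ 1 := by
  by_cases h : k = j
  · subst h; simp [withIntercept]
  · rw [withIntercept, Function.update_of_ne h]
    rcases fin_two_val_cast_cases (x k) with h | h <;> rw [h] <;> simp

/-- The unnormalised quasi-posterior mass of a set of values of the `j`-th column. -/
noncomputable def columnMass (π : Finset (Fin p) → ℝ) (ρ : ℝ) (z : Fin n → Fin p → Fin 2)
    (j : Fin p) (B : Set (Fin p → ℝ)) : ℝ≥0∞ :=
  ∫⁻ u in B, ENNReal.ofReal (columnLik z j u) ∂columnPrior π ρ

lemma isFiniteMeasure_columnPrior {π : Finset (Fin p) → ℝ} (hπ : ∀ δ, 0 ≤ π δ) {ρ : ℝ}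
    (hρ : 0 < ρ) : IsFiniteMeasure (columnPrior π ρ) := by
  refine ⟨?_⟩
  have h := setLIntegral_columnPrior_le hπ hρ (F := fun _ => 1) measurable_const
    MeasurableSet.univ zero_le_one (0 : Fin p → ℝ) (fun u _ => by
      rw [one_mul, one_mul]
      refine Real.exp_le_exp.2 ?_
      have : 0 ≤ ρ * ∑ k, |u k| := mul_nonneg hρ.le (Finset.sum_nonneg fun _ _ => abs_nonneg _)
      simp only [Pi.zero_apply, sub_zero]
      linarith) Finset.univ (by simp)
  simp only [ENNReal.ofReal_one, Measure.restrict_univ, lintegral_one] at h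
  exact h.trans_lt ENNReal.ofReal_lt_top

lemma columnMass_ne_top {π : Finset (Fin p) → ℝ} (hπ : ∀ δ, 0 ≤ π δ) {ρ : ℝ}
    (hρ : 0 < ρ) (z : Fin n → Fin p → Fin 2) (j : Fin p) (B : Set (Fin p → ℝ)) :
    columnMass π ρ z j B ≠ ⊤ := by
  have := isFiniteMeasure_columnPrior hπ hρ
  refine ne_top_of_le_ne_top (measure_ne_top (columnPrior π ρ) B) ?_
  calc columnMass π ρ z j B ≤ ∫⁻ _ in B, 1 ∂columnPrior π ρ :=
        lintegral_mono fun u => ENNReal.ofReal_le_one.2 (columnLik_le_one z j u)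
    _ = _ := by simp

lemma quasiPosteriorUnnorm_column {π : Finset (Fin p) → ℝ} (hπ : ∀ δ, 0 ≤ π δ) {ρ : ℝ}
    (hρ : 0 < ρ) (z : Fin n → Fin p → Fin 2) (j : Fin p) {B : Set (Fin p → ℝ)}
    (hB : MeasurableSet B) :
    quasiPosteriorUnnorm π ρ z {θ | (fun k => θ k j) ∈ B} =
      columnMass π ρ z j B * ∏ i ∈ Finset.univ.erase j, columnMass π ρ z i Set.univ := by
  have := isFiniteMeasure_columnPrior hπ hρ
  have hmap : Measurable fun col : Fin p → Fin p → ℝ =>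
      (Matrix.of fun k j => col j k : Matrix (Fin p) (Fin p) ℝ) := by
    change Measurable fun (col : Fin p → Fin p → ℝ) (k j : Fin p) => col j k
    fun_prop
  have hcol : ∀ j : Fin p, Measurable fun θ : Matrix (Fin p) (Fin p) ℝ => fun k => θ k j := by
    intro j
    change Measurable fun (θ : Fin p → Fin p → ℝ) (k : Fin p) => θ k j
    fun_prop
  have hA : MeasurableSet {θ : Matrix (Fin p) (Fin p) ℝ | (fun k => θ k j) ∈ B} := hcol j hB
  have hq : Measurable fun θ : Matrix (Fin p) (Fin p) ℝ =>
      ENNReal.ofReal (quasiLikelihood θ z) := by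
    simp_rw [quasiLikelihood_eq_prod]
    exact (Finset.measurable_prod _ fun j _ =>
      (measurable_columnLik z j).comp (hcol j)).ennreal_ofReal
  rw [quasiPosteriorUnnorm, withDensity_apply _ hA, matrixPrior,
    setLIntegral_map hA hq hmap, ← lintegral_indicator (hmap hA)]
  -- The event concerns column j alone, so its indicator is absorbed in the j-th factor and the
  -- integrand stays a product.
  have h1 : ∀ col : Fin p → Fin p → ℝ,
      ((fun col : Fin p → Fin p → ℝ => (Matrix.of fun k j => col j k : Matrix (Fin p) (Fin p) ℝ)) ⁻¹'
        {θ : Matrix (Fin p) (Fin p) ℝ | (fun k => θ k j) ∈ B}).indicator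
      (fun col => ENNReal.ofReal (quasiLikelihood (Matrix.of fun k j => col j k) z)) col =
      ∏ i, (if i = j then B else Set.univ).indicator
        (fun u => ENNReal.ofReal (columnLik z i u)) (col i) := by
    intro col
    by_cases hc : col j ∈ B
    · rw [Set.indicator_of_mem (by exact hc), quasiLikelihood_eq_prod,
        ENNReal.ofReal_prod_of_nonneg fun _ _ => (columnLik_pos _ _ _).le]
      refine Finset.prod_congr rfl fun i _ => ?_
      rw [Set.indicator_of_mem]
      · rfl
      · split_ifs with h
        · exact h ▸ hc
        · exact Set.mem_univ _
    · rw [Set.indicator_of_notMem (by exact hc), eq_comm]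
      refine Finset.prod_eq_zero (Finset.mem_univ j) ?_
      rw [if_pos rfl, Set.indicator_of_notMem hc]
  simp_rw [h1]
  have hm : ∀ i : Fin p, MeasurableSet (if i = j then B else Set.univ) := by
    intro i
    split_ifs
    · exact hB
    · exact MeasurableSet.univ
  rw [lintegral_fin_prod_eq_prod _ (f := fun i => (if i = j then B else Set.univ).indicator
        (fun u => ENNReal.ofReal (columnLik z i u)))
    fun i => (measurable_columnLik z i).ennreal_ofReal.indicator (hm i),
    ← Finset.mul_prod_erase _ _ (Finset.mem_univ j)]
  congr 1
  · rw [if_pos rfl, lintegral_indicator hB, columnMass]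
  · refine Finset.prod_congr rfl fun i hi => ?_
    rw [if_neg (Finset.ne_of_mem_erase hi), lintegral_indicator MeasurableSet.univ, columnMass]

/-- The masses of the other columns cancel; in `ℝ≥0∞` this requires them to be nonzero and finite.
-/
lemma quasiPosterior_column_eq {π : Finset (Fin p) → ℝ} (hπ : ∀ δ, 0 ≤ π δ) {ρ : ℝ}
    (hρ : 0 < ρ) (z : Fin n → Fin p → Fin 2)
    (hpos : ∀ i, columnMass π ρ z i Set.univ ≠ 0) (j : Fin p) {B : Set (Fin p → ℝ)}
    (hB : MeasurableSet B) :
    quasiPosterior π ρ z {θ | (fun k => θ k j) ∈ B} =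
      columnMass π ρ z j B / columnMass π ρ z j Set.univ := by
  have h1 := quasiPosteriorUnnorm_column hπ hρ z j hB
  have h2 := quasiPosteriorUnnorm_column hπ hρ z j MeasurableSet.univ
  simp only [Set.mem_univ, Set.ofPred_true] at h2
  rw [quasiPosterior, Measure.smul_apply, smul_eq_mul, h1, h2, mul_comm, ← div_eq_mul_inv]
  refine ENNReal.mul_div_mul_right _ _ ?_ ?_
  · exact Finset.prod_ne_zero_iff.2 fun i _ => hpos i
  · exact ENNReal.prod_ne_top fun i _ => columnMass_ne_top hπ hρ z i _

lemma quasiPosterior_le_one (π : Finset (Fin p) → ℝ) (ρ : ℝ) (z : Fin n → Fin p → Fin 2)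
    (A : Set (Matrix (Fin p) (Fin p) ℝ)) : quasiPosterior π ρ z A ≤ 1 := by
  rw [quasiPosterior, Measure.smul_apply, smul_eq_mul]
  exact (mul_le_mul_right (measure_mono (Set.subset_univ A)) _).trans
    (ENNReal.inv_mul_le_one _)

/-! ### Expectations under the Ising model and concentration of the score and the information -/

lemma isingWeight_pos (θ : Matrix (Fin p) (Fin p) ℝ) (x : Fin p → Fin 2) : 0 < isingWeight θ x :=
  Real.exp_pos _

lemma sum_isingWeight_pos (θ : Matrix (Fin p) (Fin p) ℝ) : 0 < ∑ y, isingWeight θ y :=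
  Finset.sum_pos (fun _ _ => isingWeight_pos θ _) Finset.univ_nonempty

lemma isingPMF_nonneg (θ : Matrix (Fin p) (Fin p) ℝ) (x : Fin p → Fin 2) : 0 ≤ isingPMF θ x :=
  div_nonneg (isingWeight_pos θ x).le (sum_isingWeight_pos θ).le

lemma sum_isingPMF (θ : Matrix (Fin p) (Fin p) ℝ) : ∑ x, isingPMF θ x = 1 := by
  simp only [isingPMF]
  rw [← Finset.sum_div, div_self (sum_isingWeight_pos θ).ne']

/-- The increment of the energy of the Ising model when the `j`-th spin is switched on. -/
lemma energy_switch_on {θ : Matrix (Fin p) (Fin p) ℝ} (hθ : θ.IsSymm) {j : Fin p}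
    {y₀ y₁ : Fin p → ℝ} (h₀ : y₀ j = 0) (h₁ : y₁ j = 1) (h : ∀ k, k ≠ j → y₁ k = y₀ k) :
    (∑ b, θ b b * y₁ b + ∑ b, ∑ i with i < b, θ i b * y₁ i * y₁ b) =
      (∑ b, θ b b * y₀ b + ∑ b, ∑ i with i < b, θ i b * y₀ i * y₀ b) + ∑ k, θ k j * y₁ k
      := by
  have hy : ∀ k, y₁ k = y₀ k + if k = j then 1 else 0 := by
    intro k
    split_ifs with hk
    · rw [hk, h₀, h₁]; ring
    · rw [h k hk]; ring
  have e1 : ∑ b, θ b b * y₁ b = ∑ b, θ b b * y₀ b + θ j j := by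
    simp_rw [hy, mul_add, Finset.sum_add_distrib]
    simp
  -- Switching on spin j creates the pairs (j, b) with j < b and, for b = j, all pairs (i, j) with i
  -- < j.
  have e2 : ∀ b, ∑ i with i < b, θ i b * y₁ i * y₁ b = ∑ i with i < b, θ i b * y₀ i * y₀ b +
      ((if j < b then θ j b * y₀ b else 0) +
      if b = j then ∑ i with i < j, θ i j * y₀ i else 0) := by
    intro b
    have : (if j < b then θ j b * y₀ b else 0) =
        ∑ i with i < b, if i = j then θ i b * y₀ b else 0 := by
      rw [Finset.sum_filter]
      simp only [← ite_and]
      rw [Finset.sum_eq_single j]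
      · simp
      · intro i _ hi; simp [hi]
      · simp
    rw [this]
    by_cases hb : b = j
    · subst hb
      rw [if_pos rfl, ← Finset.sum_add_distrib, ← Finset.sum_add_distrib]
      refine Finset.sum_congr rfl fun i hi => ?_
      have hi' : i ≠ b := (Finset.mem_filter.1 hi).2.ne
      rw [hy i, hy b, if_neg hi', if_neg hi', if_pos rfl, h₀]
      ring
    · rw [if_neg hb, add_zero, ← Finset.sum_add_distrib]
      refine Finset.sum_congr rfl fun i hi => ?_
      rw [hy i, hy b, if_neg hb]
      split_ifs <;> ring
  have e3 : ∑ k, θ k j * y₁ k = θ j j + (∑ b with j < b, θ j b * y₀ b +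
      ∑ i with i < j, θ i j * y₀ i) := by
    rw [← Finset.add_sum_erase _ _ (Finset.mem_univ j), h₁, mul_one]
    congr 1
    rw [Finset.sum_filter, Finset.sum_filter, ← Finset.sum_add_distrib,
      ← Finset.add_sum_erase Finset.univ _ (Finset.mem_univ j)]
    simp only [lt_irrefl, if_false, add_zero, zero_add]
    refine Finset.sum_congr rfl fun k hk => ?_
    have hk' := Finset.ne_of_mem_erase hk
    rw [h k hk']
    rcases lt_or_gt_of_ne hk' with hlt | hlt
    · rw [if_neg hlt.not_gt, if_pos hlt, zero_add]
    -- Symmetry enters here: the energy reads the entry (j, k) above the diagonal, while the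
    -- regression reads (k, j) in column j.
    · rw [if_neg hlt.not_gt, if_pos hlt, add_zero, hθ.apply]
  rw [e1, e3, Finset.sum_congr rfl fun b _ => e2 b, Finset.sum_add_distrib,
    Finset.sum_add_distrib]
  simp only [Finset.sum_ite_eq', Finset.mem_univ, if_true]
  rw [Finset.sum_filter (fun b => j < b)]
  ring

lemma isingWeight_update_one {θ : Matrix (Fin p) (Fin p) ℝ} (hθ : θ.IsSymm) (j : Fin p)
    (x : Fin p → Fin 2) :
    isingWeight θ (Function.update x j 1) =
      isingWeight θ (Function.update x j 0) * Real.exp (∑ k, θ k j * withIntercept j x k) := by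
  rw [isingWeight, isingWeight, ← Real.exp_add]
  congr 1
  have hw : ∀ k, withIntercept j x k = (((Function.update x j 1) k).val : ℝ) := by
    intro k
    by_cases hk : k = j
    · subst hk; simp [withIntercept]
    · simp [withIntercept, Function.update_of_ne hk]
  simp_rw [hw]
  exact energy_switch_on hθ (y₀ := fun k => (((Function.update x j 0) k).val : ℝ))
    (y₁ := fun k => (((Function.update x j 1) k).val : ℝ)) (by simp) (by simp)
    (fun k hk => by simp [Function.update_of_ne hk])

lemma withIntercept_update (j : Fin p) (x : Fin p → Fin 2) (b : Fin 2) :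
    withIntercept j (Function.update x j b) = withIntercept j x := by
  funext k
  by_cases hk : k = j
  · subst hk; simp [withIntercept]
  · simp [withIntercept, Function.update_of_ne hk]

/-- The score of the `j`-th logistic regression is centred under a symmetric Ising model. -/
lemma sum_isingPMF_mul_score {θ : Matrix (Fin p) (Fin p) ℝ} (hθ : θ.IsSymm) (j k : Fin p) :
    ∑ x, isingPMF θ x * ((((x j).val : ℝ) -
      Real.sigmoid (∑ l, θ l j * withIntercept j x l)) * withIntercept j x k) = 0 := by
  set F : (Fin p → Fin 2) → ℝ := fun x => isingWeight θ x * ((((x j).val : ℝ) -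
      Real.sigmoid (∑ l, θ l j * withIntercept j x l)) * withIntercept j x k) with hF
  -- Flipping spin j reverses the sign of the weighted score. The covariates are unchanged and the
  -- two weights are in ratio exp a, so this expresses that X_j given the rest is Bernoulli with
  -- mean σ(a).
  have hflip : ∀ x, F (Function.update x j (1 - x j)) = - F x := by
    have key : ∀ x, F (Function.update x j 1) = - F (Function.update x j 0) := by
      intro x
      simp only [hF, withIntercept_update, Function.update_self, isingWeight_update_one hθ]
      rw [sigmoid_eq_exp_div]
      have := Real.exp_pos (∑ l, θ l j * withIntercept j x l)
      set E := Real.exp (∑ l, θ l j * withIntercept j x l)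
      simp only [Fin.val_one, Fin.val_zero, Nat.cast_one, Nat.cast_zero]
      field_simp
      ring
    intro x
    have hx : x j = 0 ∨ x j = 1 := by
      generalize x j = b
      fin_cases b <;> simp
    rcases hx with h | h
    · have : Function.update x j 0 = x := by rw [← h, Function.update_eq_self]
      rw [h, sub_zero, key, this]
    · have : Function.update x j 1 = x := by rw [← h, Function.update_eq_self]
      have h2 := key x
      rw [this] at h2
      rw [h, sub_self, h2, neg_neg]
  have hinv : Function.Involutive fun x : Fin p → Fin 2 => Function.update x j (1 - x j) := by
    intro x
    simp
  have h1 : ∑ x, F (Function.update x j (1 - x j)) = ∑ x, F x := Equiv.sum_comp hinv.toPerm F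
  simp_rw [hflip, Finset.sum_neg_distrib] at h1
  have h2 : ∑ x, F x = 0 := by linarith
  simp only [isingPMF, div_mul_eq_mul_div]
  rw [← Finset.sum_div]
  simp only [hF] at h2
  rw [h2, zero_div]

lemma fisher_apply (θ : Matrix (Fin p) (Fin p) ℝ) (j k l : Fin p) :
    fisher θ j k l = ∑ x, isingPMF θ x *
      (Real.sigmoid (∑ m, θ m j * withIntercept j x m) *
        (1 - Real.sigmoid (∑ m, θ m j * withIntercept j x m)) *
        withIntercept j x k * withIntercept j x l) := by
  rw [fisher, Matrix.sum_apply]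
  refine Finset.sum_congr rfl fun x _ => ?_
  rw [Matrix.smul_apply, Matrix.vecMulVec_apply, iteratedDeriv_two_logPartition, smul_eq_mul]
  ring

/-! ### Hoeffding bounds for Ising samples. -/

section Sample

variable {Ω : Type*} [MeasurableSpace Ω] {P : Measure Ω} [IsProbabilityMeasure P]
  {θ : Matrix (Fin p) (Fin p) ℝ} {X : Fin n → Ω → Fin p → Fin 2}

lemma IsIsingSample.integral_comp (hX : IsIsingSample P θ X) (i : Fin n)
    (F : (Fin p → Fin 2) → ℝ) : ∫ ω, F (X i ω) ∂P = ∑ x, isingPMF θ x * F x := by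
  have hm := hX.measurable i
  have : IsProbabilityMeasure (P.map (X i)) := Measure.isProbabilityMeasure_map hm.aemeasurable
  rw [← integral_map hm.aemeasurable (by fun_prop), integral_fintype Integrable.of_finite]
  refine Finset.sum_congr rfl fun x _ => ?_
  rw [smul_eq_mul, map_measureReal_apply hm (measurableSet_singleton x), Measure.real, hX.law,
    ENNReal.toReal_ofReal (isingPMF_nonneg θ x)]

lemma IsIsingSample.measure_sum_ge_le (hX : IsIsingSample P θ X) {F : (Fin p → Fin 2) → ℝ}
    (hF : ∀ x, |F x| ≤ 1) {t : ℝ} (ht : 0 ≤ t) :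
    P.real {ω | t ≤ ∑ i, (F (X i ω) - ∑ x, isingPMF θ x * F x)} ≤
      Real.exp (-t ^ 2 / (2 * n)) := by
  have hsub : ∀ i, HasSubgaussianMGF (fun ω => F (X i ω) - ∑ x, isingPMF θ x * F x) 1 P := by
    intro i
    have h := hasSubgaussianMGF_of_mem_Icc (μ := P) (X := fun ω => F (X i ω)) (a := -1) (b := 1)
      ((measurable_of_finite F).comp (hX.measurable i)).aemeasurable
      (Filter.Eventually.of_forall fun ω => abs_le.1 (hF _))
    rw [hX.integral_comp i F] at h
    -- The sub-Gaussian parameter of a variable in [-1, 1] is ((1 - (-1))/2)² = 1.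
    convert h using 1
    ext
    norm_num
  have hind : iIndepFun (fun i ω => F (X i ω) - ∑ x, isingPMF θ x * F x) P :=
    hX.indep.comp (fun _ x => F x - ∑ x, isingPMF θ x * F x) fun _ => measurable_of_finite _
  have := HasSubgaussianMGF.measure_sum_ge_le_of_iIndepFun hind (s := Finset.univ)
    (fun i _ => hsub i) ht
  simpa using this

lemma IsIsingSample.measure_lt_abs_sum_le (hX : IsIsingSample P θ X) {F : (Fin p → Fin 2) → ℝ}
    (hF : ∀ x, |F x| ≤ 1) {t : ℝ} (ht : 0 ≤ t) :
    P {ω | t < |∑ i, F (X i ω) - n * ∑ x, isingPMF θ x * F x|} ≤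
      ENNReal.ofReal (2 * Real.exp (-t ^ 2 / (2 * n))) := by
  have h1 := hX.measure_sum_ge_le hF ht
  have h2 := hX.measure_sum_ge_le (F := fun x => - F x) (fun x => by rw [abs_neg]; exact hF x) ht
  have hsub : {ω | t < |∑ i, F (X i ω) - n * ∑ x, isingPMF θ x * F x|} ⊆
      {ω | t ≤ ∑ i, (F (X i ω) - ∑ x, isingPMF θ x * F x)} ∪
      {ω | t ≤ ∑ i, (- F (X i ω) - ∑ x, isingPMF θ x * - F x)} := by
    intro ω hω
    simp only [Set.mem_ofPred_eq, Set.mem_union, Finset.sum_sub_distrib, Finset.sum_const,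
      Finset.card_univ, Fintype.card_fin, nsmul_eq_mul, mul_neg, Finset.sum_neg_distrib] at hω ⊢
    rcases lt_abs.1 hω with h | h
    · exact Or.inl h.le
    · right; linarith
  refine (ENNReal.le_ofReal_iff_toReal_le (measure_ne_top _ _) (by positivity)).2 ?_
  change P.real _ ≤ _
  calc _ ≤ _ := measureReal_mono hsub
    _ ≤ _ := measureReal_union_le _ _
    _ ≤ _ := by linarith

/-- The score at `θ` and the deviation of the observed information from the Fisher information
are entrywise bounded, in all the column-wise logistic regressions. -/
def RegularData (θ : Matrix (Fin p) (Fin p) ℝ) (R r : ℝ) (z : Fin n → Fin p → Fin 2) : Prop :=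
  (∀ j k, |logisticScore (covariates z j) (response z j) (fun l => θ l j) k| ≤ R) ∧
  ∀ j k l, |logisticInfo (covariates z j) (fun l => θ l j) k l - n * fisher θ j k l| ≤ r

lemma IsIsingSample.measure_not_regularData_le (hX : IsIsingSample P θ X) (hθ : θ.IsSymm)
    {R r η : ℝ} (hR : 0 ≤ R) (hr : 0 ≤ r) (hRη : Real.exp (-R ^ 2 / (2 * n)) ≤ η)
    (hrη : Real.exp (-r ^ 2 / (2 * n)) ≤ η) :
    P {ω | ¬ RegularData θ R r fun i => X i ω} ≤ ENNReal.ofReal ((p ^ 2 + p ^ 3) * (2 * η)) := by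
  have hη : 0 ≤ η := (Real.exp_pos _).le.trans hRη
  have hv : ∀ j k (x : Fin p → Fin 2), |withIntercept j x k| ≤ 1 :=
    fun j k x => abs_withIntercept_le_one j x k
  have h1 : ∀ j k, P {ω | R < |logisticScore (covariates (fun i => X i ω) j)
      (response (fun i => X i ω) j) (fun l => θ l j) k|} ≤ ENNReal.ofReal (2 * η) := by
    intro j k
    have := hX.measure_lt_abs_sum_le (F := fun x => (((x j).val : ℝ) -
      Real.sigmoid (∑ l, θ l j * withIntercept j x l)) * withIntercept j x k) (fun x => by
        rw [abs_mul]
        refine mul_le_one₀ ?_ (abs_nonneg _) (hv j k x)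
        have h0 := Real.sigmoid_nonneg (∑ l, θ l j * withIntercept j x l)
        have h1 := Real.sigmoid_le_one (∑ l, θ l j * withIntercept j x l)
        rw [abs_le]
        rcases fin_two_val_cast_cases (x j) with h | h <;> rw [h] <;> constructor <;> linarith) hR
    rw [sum_isingPMF_mul_score hθ] at this
    simp only [mul_zero, sub_zero] at this
    exact this.trans (ENNReal.ofReal_le_ofReal (by linarith))
  have h2 : ∀ j k l, P {ω | r < |logisticInfo (covariates (fun i => X i ω) j)
      (fun l => θ l j) k l - n * fisher θ j k l|} ≤ ENNReal.ofReal (2 * η) := by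
    intro j k l
    have := hX.measure_lt_abs_sum_le (F := fun x =>
      (Real.sigmoid (∑ m, θ m j * withIntercept j x m) *
        (1 - Real.sigmoid (∑ m, θ m j * withIntercept j x m)) *
        withIntercept j x k * withIntercept j x l)) (fun x => by
        rw [abs_mul, abs_mul, abs_of_nonneg (sigmoid_variance_nonneg _)]
        refine mul_le_one₀ (mul_le_one₀ (sigmoid_variance_le_one _) (abs_nonneg _) (hv j k x))
          (abs_nonneg _) (hv j l x)) hr
    rw [← fisher_apply] at this
    exact this.trans (ENNReal.ofReal_le_ofReal (by linarith))
  have hsub : {ω | ¬ RegularData θ R r fun i => X i ω} ⊆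
      (⋃ j, ⋃ k, {ω | R < |logisticScore (covariates (fun i => X i ω) j)
        (response (fun i => X i ω) j) (fun l => θ l j) k|}) ∪
      ⋃ j, ⋃ k, ⋃ l, {ω | r < |logisticInfo (covariates (fun i => X i ω) j)
        (fun l => θ l j) k l - n * fisher θ j k l|} := by
    intro ω hω
    by_contra hcon
    simp only [Set.mem_union, Set.mem_iUnion, Set.mem_ofPred_eq, not_or, not_exists, not_lt]
      at hcon
    exact hω ⟨hcon.1, hcon.2⟩
  have hu1 : P (⋃ j, ⋃ k, {ω | R < |logisticScore (covariates (fun i => X i ω) j)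
        (response (fun i => X i ω) j) (fun l => θ l j) k|}) ≤
      p ^ 2 * ENNReal.ofReal (2 * η) := by
    calc _ ≤ ∑ j : Fin p, ∑ k : Fin p, ENNReal.ofReal (2 * η) :=
          (measure_iUnion_fintype_le _ _).trans (Finset.sum_le_sum fun j _ =>
            (measure_iUnion_fintype_le _ _).trans (Finset.sum_le_sum fun k _ => h1 j k))
      _ = _ := by simp [sq, mul_assoc]
  have hu2 : P (⋃ j, ⋃ k, ⋃ l, {ω | r < |logisticInfo (covariates (fun i => X i ω) j)
        (fun l => θ l j) k l - n * fisher θ j k l|}) ≤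
      p ^ 3 * ENNReal.ofReal (2 * η) := by
    calc _ ≤ ∑ j : Fin p, ∑ k : Fin p, ∑ l : Fin p, ENNReal.ofReal (2 * η) :=
          (measure_iUnion_fintype_le _ _).trans (Finset.sum_le_sum fun j _ =>
            (measure_iUnion_fintype_le _ _).trans (Finset.sum_le_sum fun k _ =>
            (measure_iUnion_fintype_le _ _).trans (Finset.sum_le_sum fun l _ => h2 j k l)))
      _ = _ := by simp [pow_succ, mul_assoc]
  refine (measure_mono hsub).trans ((measure_union_le _ _).trans ((add_le_add hu1 hu2).trans ?_))
  rw [← add_mul, ENNReal.ofReal_mul (p := (p : ℝ) ^ 2 + (p : ℝ) ^ 3) (by positivity)]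
  refine le_of_eq ?_
  congr 1
  rw [ENNReal.ofReal_add (by positivity) (by positivity), ENNReal.ofReal_pow (by positivity),
    ENNReal.ofReal_pow (by positivity), ENNReal.ofReal_natCast]

end Sample

/-! ### Restricted strong concavity of the column log-likelihoods -/

lemma dotProduct_mulVec_eq_sum (H : Matrix (Fin p) (Fin p) ℝ) (u : Fin p → ℝ) :
    u ⬝ᵥ (H *ᵥ u) = ∑ k, ∑ l, H k l * (u k * u l) := by
  simp only [dotProduct, Matrix.mulVec, Finset.mul_sum]
  exact Finset.sum_congr rfl fun k _ => Finset.sum_congr rfl fun l _ => by ring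

lemma sum_sq_pos_of_ne_zero {u : Fin p → ℝ} (hu : u ≠ 0) : 0 < ∑ k, u k ^ 2 := by
  obtain ⟨k, hk⟩ := Function.ne_iff.1 hu
  exact Finset.sum_pos' (fun _ _ => sq_nonneg _) ⟨k, Finset.mem_univ k, by
    have : u k ≠ 0 := hk
    positivity⟩

lemma toReal_mul_le_of_le_rayleigh {θ : Matrix (Fin p) (Fin p) ℝ} {j : Fin p} {u : Fin p → ℝ}
    {κ : ℝ≥0∞} (hκ : 0 < κ) (hu : u ≠ 0) (h : κ ≤ rayleigh θ j u) :
    κ.toReal * ∑ k, u k ^ 2 ≤ ∑ k, ∑ l, fisher θ j k l * (u k * u l) := by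
  have hpos := ENNReal.ofReal_pos.1 (hκ.trans_le h)
  have := ENNReal.toReal_le_of_le_ofReal hpos.le h
  rwa [le_div_iff₀ (sum_sq_pos_of_ne_zero hu), dotProduct_mulVec_eq_sum] at this

lemma kappaSparse_le_rayleigh {θ : Matrix (Fin p) (Fin p) ℝ} {s : ℕ} (j : Fin p)
    {u : Fin p → ℝ} (hu : u ≠ 0) (hs : l0 u ≤ s) : kappaSparse θ s ≤ rayleigh θ j u :=
  iInf_le_of_le j (iInf_le_of_le u (iInf_le_of_le ⟨hu, hs⟩ le_rfl))

/-- `kappaCone` only involves directions in the cone of the same column. -/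
lemma kappaCone_le_rayleigh {θ : Matrix (Fin p) (Fin p) ℝ} (j : Fin p) {u : Fin p → ℝ}
    (hu : u ≠ 0) (hc : ∑ k with θ k j = 0, |u k| ≤ 7 * ∑ k with θ k j ≠ 0, |u k|) :
    kappaCone θ ≤ rayleigh θ j u :=
  iInf_le_of_le j (iInf_le_of_le u (iInf_le_of_le ⟨hu, hc⟩ le_rfl))

lemma fisher_diag_le_one (θ : Matrix (Fin p) (Fin p) ℝ) (j k : Fin p) : fisher θ j k k ≤ 1 := by
  rw [fisher_apply]
  refine (Finset.sum_le_sum fun x _ => ?_).trans_eq (sum_isingPMF θ)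
  refine mul_le_of_le_one_right (isingPMF_nonneg θ x) ?_
  rw [mul_assoc, ← abs_mul_abs_self]
  have h := abs_withIntercept_le_one j x k
  exact mul_le_one₀ (sigmoid_variance_le_one _) (by positivity) (mul_le_one₀ h (abs_nonneg _) h)

/-- A basis vector is a test vector, and the diagonal of the Fisher information is at most 1. In
particular `kappa` is finite, so its real value is positive when it is. -/
lemma kappaSparse_le_one {θ : Matrix (Fin p) (Fin p) ℝ} {s : ℕ} (hs : 1 ≤ s) (j : Fin p) :
    kappaSparse θ s ≤ 1 := by
  have hne : (Pi.single j 1 : Fin p → ℝ) ≠ 0 := by simp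
  have hl0 : l0 (Pi.single j 1 : Fin p → ℝ) ≤ s := by
    refine le_trans (l0_le_card (δ := {j}) ?_) (by simpa using hs)
    intro k hk
    rw [Pi.single_eq_of_ne (by simpa using hk)]
  refine (kappaSparse_le_rayleigh j hne hl0).trans ?_
  rw [rayleigh, ENNReal.ofReal_le_one]
  have h1 : ∑ k, (Pi.single j 1 : Fin p → ℝ) k ^ 2 = 1 := by
    rw [Finset.sum_eq_single j] <;> simp +contextual
  rw [h1, div_one]
  simpa using fisher_diag_le_one θ j j

lemma abs_quadForm_sub_le {A H : Fin p → Fin p → ℝ} {c r : ℝ}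
    (h : ∀ k l, |A k l - c * H k l| ≤ r) (d : Fin p → ℝ) :
    |∑ k, ∑ l, A k l * (d k * d l) - c * ∑ k, ∑ l, H k l * (d k * d l)| ≤
      r * (∑ k, |d k|) ^ 2 := by
  have e1 : ∑ k, ∑ l, A k l * (d k * d l) - c * ∑ k, ∑ l, H k l * (d k * d l) =
      ∑ k, ∑ l, (A k l - c * H k l) * (d k * d l) := by
    simp only [Finset.mul_sum, ← Finset.sum_sub_distrib]
    exact Finset.sum_congr rfl fun k _ => Finset.sum_congr rfl fun l _ => by ring
  have e2 : r * (∑ k, |d k|) ^ 2 = ∑ k, ∑ l, r * (|d k| * |d l|) := by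
    rw [sq, Finset.sum_mul_sum, Finset.mul_sum]
    simp only [Finset.mul_sum]
  rw [e1, e2]
  refine (Finset.abs_sum_le_sum_abs _ _).trans (Finset.sum_le_sum fun k _ =>
    (Finset.abs_sum_le_sum_abs _ _).trans (Finset.sum_le_sum fun l _ => ?_))
  rw [abs_mul, abs_mul]
  exact mul_le_mul_of_nonneg_right (h k l) (by positivity)

lemma logisticInfo_quadForm_nonneg (x : Fin n → Fin p → ℝ) (v d : Fin p → ℝ) :
    0 ≤ ∑ k, ∑ l, logisticInfo x v k l * (d k * d l) := by
  rw [← sum_sigmoid_variance_mul_sq]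
  exact Finset.sum_nonneg fun i _ => mul_nonneg (sigmoid_variance_nonneg _) (sq_nonneg _)

lemma sq_sum_abs_le_card_mul (A : Finset (Fin p)) (d : Fin p → ℝ) :
    (∑ k ∈ A, |d k|) ^ 2 ≤ A.card * ∑ k, d k ^ 2 := by
  refine sq_sum_le_card_mul_sum_sq.trans (mul_le_mul_of_nonneg_left ?_ (Nat.cast_nonneg _))
  simp only [sq_abs]
  exact Finset.sum_le_sum_of_subset_of_nonneg (Finset.subset_univ _) fun _ _ _ => sq_nonneg _

lemma sq_sum_abs_le_l0_mul (d : Fin p → ℝ) :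
    (∑ k, |d k|) ^ 2 ≤ l0 d * ∑ k, d k ^ 2 := by
  have h := sq_sum_abs_le_card_mul (Finset.univ.filter fun k => d k ≠ 0) d
  rwa [Finset.sum_filter_of_ne fun k _ hk => by simpa using hk] at h

/-- The quadratic form of the observed information dominates half of the one of the Fisher
information in directions where the latter is coercive and the `ℓ¹` norm is controlled. -/
lemma half_le_logisticInfo {θ : Matrix (Fin p) (Fin p) ℝ} {R r : ℝ} {z : Fin n → Fin p → Fin 2}
    (hz : RegularData θ R r z) (j : Fin p) {d : Fin p → ℝ} {κ m : ℝ} (hr : 0 ≤ r)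
    (hκ : κ * ∑ k, d k ^ 2 ≤ ∑ k, ∑ l, fisher θ j k l * (d k * d l))
    (hm : (∑ k, |d k|) ^ 2 ≤ m * ∑ k, d k ^ 2) (hrm : 2 * (r * m) ≤ n * κ) :
    n * κ / 2 * ∑ k, d k ^ 2 ≤
      ∑ k, ∑ l, logisticInfo (covariates z j) (fun l => θ l j) k l * (d k * d l) := by
  have h := (abs_le.1 (abs_quadForm_sub_le (hz.2 j) d)).1
  have hn : (0 : ℝ) ≤ n := Nat.cast_nonneg n
  have h0 : 0 ≤ ∑ k, d k ^ 2 := Finset.sum_nonneg fun _ _ => sq_nonneg _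
  have h1 := mul_le_mul_of_nonneg_left hκ hn
  have h2 := mul_le_mul_of_nonneg_left hm hr
  have h3 := mul_le_mul_of_nonneg_right hrm h0
  nlinarith

/-! ### Pointwise bounds for the penalised likelihood of a column -/

lemma sum_abs_sub_sum_abs_le (u v : Fin p → ℝ) :
    ∑ k, |v k| - ∑ k, |u k| ≤
      ∑ k with v k ≠ 0, |u k - v k| - ∑ k with v k = 0, |u k - v k| := by
  rw [← Finset.sum_sub_distrib, Finset.sum_filter, Finset.sum_filter, ← Finset.sum_sub_distrib]
  refine Finset.sum_le_sum fun k _ => ?_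
  by_cases hk : v k = 0
  · simp [hk]
  · simp only [hk, ne_eq, not_false_eq_true, if_true, if_false, sub_zero]
    have := abs_sub_abs_le_abs_sub (v k) (u k)
    rwa [abs_sub_comm] at this

lemma sum_abs_eq_add (v d : Fin p → ℝ) :
    ∑ k, |d k| = ∑ k with v k ≠ 0, |d k| + ∑ k with v k = 0, |d k| := by
  rw [add_comm, Finset.sum_filter_add_sum_filter_not]

/-- The penalised likelihood of the `j`-th column at `v`. -/
noncomputable def penalizedLik (z : Fin n → Fin p → Fin 2) (j : Fin p) (ρ : ℝ) (v : Fin p → ℝ) :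
    ℝ :=
  columnLik z j v * Real.exp (-ρ * ∑ k, |v k|)

lemma penalizedLik_pos (z : Fin n → Fin p → Fin 2) (j : Fin p) (ρ : ℝ) (v : Fin p → ℝ) :
    0 < penalizedLik z j ρ v := mul_pos (columnLik_pos _ _ _) (Real.exp_pos _)

/-- With B and C the ℓ¹ masses of u - θ on and off the support, the score costs ρ(B + C)/2, the
penalty gives ρ(B - C), and ρ(B + C)/4 is set aside to keep the bound integrable. The total is 7ρB/4
- ρC/4, which explains the constant 7 in the cone. -/
lemma penalizedLik_le {θ : Matrix (Fin p) (Fin p) ℝ} {ρ r : ℝ} {z : Fin n → Fin p → Fin 2}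
    (hz : RegularData θ (ρ / 2) r z) (hρ : 0 ≤ ρ) (j : Fin p) (u : Fin p → ℝ) {E : ℝ}
    (hE : 7 / 4 * ρ * ∑ k with θ k j ≠ 0, |u k - θ k j| -
      ρ / 4 * ∑ k with θ k j = 0, |u k - θ k j| -
      (∑ k, ∑ l, logisticInfo (covariates z j) (fun l => θ l j) k l *
        ((u k - θ k j) * (u l - θ l j))) / (2 + ∑ k, |u k - θ k j|) ≤ E) :
    columnLik z j u * Real.exp (-ρ * ∑ k, |u k|) ≤
      penalizedLik z j ρ (fun k => θ k j) * Real.exp E *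
        Real.exp (-(ρ / 4 * ∑ k, |u k - θ k j|)) := by
  have h1 := logisticLogLik_le (u := u) (fun i k => abs_withIntercept_le_one j (z i) k) (hz.1 j)
  have h2 := mul_le_mul_of_nonneg_left (sum_abs_sub_sum_abs_le u (fun k => θ k j)) hρ
  have h3 := sum_abs_eq_add (fun k => θ k j) (fun k => u k - θ k j)
  rw [penalizedLik, columnLik, columnLik, ← Real.exp_add, ← Real.exp_add, ← Real.exp_add,
    ← Real.exp_add]
  refine Real.exp_le_exp.2 ?_
  unfold covariates at hE ⊢
  rw [h3] at h1 hE ⊢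
  linarith

/-- On the box ρ‖u - θ‖₁ ≤ s. The score loses s/2, the penalty s, and the second-order term
n(s/ρ)²/2. -/
lemma le_penalizedLik {θ : Matrix (Fin p) (Fin p) ℝ} {ρ r : ℝ} {z : Fin n → Fin p → Fin 2}
    (hz : RegularData θ (ρ / 2) r z) (hρ : 0 < ρ) (j : Fin p) {u : Fin p → ℝ}
    (hu : ∀ k, θ k j = 0 → u k = 0) (hu' : ∀ k, |u k - θ k j| ≤ 1 / ρ) :
    penalizedLik z j ρ (fun k => θ k j) *
      Real.exp (-(3 / 2 * colSparsity θ j + n * (colSparsity θ j) ^ 2 / (2 * ρ ^ 2))) ≤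
      columnLik z j u * Real.exp (-ρ * ∑ k, |u k|) := by
  have h1 := le_logisticLogLik (u := u) (fun i k => abs_withIntercept_le_one j (z i) k) (hz.1 j)
  have h2 : ∑ k, |u k - θ k j| ≤ colSparsity θ j / ρ := by
    calc ∑ k, |u k - θ k j| = ∑ k with θ k j ≠ 0, |u k - θ k j| := by
          rw [Finset.sum_filter_of_ne]
          intro k _ hk h0
          exact hk (by rw [hu k h0, h0]; simp)
      _ ≤ ∑ k with θ k j ≠ 0, 1 / ρ := Finset.sum_le_sum fun k _ => hu' k
      _ = _ := by
          rw [Finset.sum_const, nsmul_eq_mul, colSparsity, l0]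
          ring
  have h3 : ∑ k, |u k| ≤ ∑ k, |θ k j| + ∑ k, |u k - θ k j| := by
    rw [← Finset.sum_add_distrib]
    refine Finset.sum_le_sum fun k _ => ?_
    have := abs_add_le (θ k j) (u k - θ k j)
    rwa [add_sub_cancel] at this
  have h0 : 0 ≤ ∑ k, |u k - θ k j| := Finset.sum_nonneg fun _ _ => abs_nonneg _
  rw [penalizedLik, columnLik, columnLik, ← Real.exp_add, ← Real.exp_add, ← Real.exp_add]
  refine Real.exp_le_exp.2 ?_
  set N := ∑ k, |u k - θ k j|
  set s : ℝ := (colSparsity θ j : ℝ)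
  have h4 : ρ * N ≤ s := by
    rw [le_div_iff₀ hρ] at h2
    linarith
  have h5 : n * N ^ 2 / 2 ≤ n * s ^ 2 / (2 * ρ ^ 2) := by
    have : N ^ 2 ≤ (s / ρ) ^ 2 := pow_le_pow_left₀ h0 h2 2
    calc n * N ^ 2 / 2 ≤ n * (s / ρ) ^ 2 / 2 := by gcongr
      _ = _ := by field_simp
  have h6 := mul_le_mul_of_nonneg_left h3 hρ.le
  unfold covariates
  linarith

/-- For B ≤ 1/4 the curvature term is quadratic and the bound is the arithmetic-geometric mean
inequality. For larger B it is at least linear and absorbs 2ρB outright, since 64ρs ≤ m. -/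
lemma cone_exponent_le {ρ m s B : ℝ} (hs : 0 < s) (hB : 0 ≤ B) (hm : 0 < m)
    (h : 64 * ρ * s ≤ m) :
    2 * ρ * B - m * B ^ 2 / (4 * s * (1 + 4 * B)) ≤ 8 * ρ ^ 2 * s / m := by
  rcases le_total (4 * B) 1 with h4 | h4
  · have h1 : m * B ^ 2 / (8 * s) ≤ m * B ^ 2 / (4 * s * (1 + 4 * B)) := by
      apply div_le_div_of_nonneg_left (by positivity) (by positivity)
      nlinarith
    have h2 : 2 * ρ * B ≤ 8 * ρ ^ 2 * s / m + m * B ^ 2 / (8 * s) := by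
      rw [div_add_div _ _ hm.ne' (by positivity), le_div_iff₀ (by positivity)]
      nlinarith [sq_nonneg (8 * ρ * s - m * B)]
    linarith
  · have h1 : m * B / (32 * s) ≤ m * B ^ 2 / (4 * s * (1 + 4 * B)) := by
      rw [div_le_div_iff₀ (by positivity) (by positivity)]
      have : 0 ≤ m * B * s * (4 * B - 1) := by
        have : 0 ≤ 4 * B - 1 := by linarith
        positivity
      nlinarith
    have h2 : 2 * ρ * B ≤ m * B / (32 * s) := by
      rw [le_div_iff₀ (by positivity)]
      nlinarith
    have h3 : 0 ≤ 8 * ρ ^ 2 * s / m := by positivity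
    linarith

/-- Away from the support, the penalty dominates; on the cone, the curvature does. -/
lemma penalizedLik_le_of_kappaCone {θ : Matrix (Fin p) (Fin p) ℝ} {ρ r κ : ℝ}
    {z : Fin n → Fin p → Fin 2} (hz : RegularData θ (ρ / 2) r z) (hρ : 0 ≤ ρ) (hr : 0 ≤ r)
    (hn : 0 < n) (hκ : 0 < κ) (hκc : ENNReal.ofReal κ ≤ kappaCone θ) (j : Fin p)
    (hrs : 128 * r * colSparsity θ j ≤ n * κ) (hρs : 64 * ρ * colSparsity θ j ≤ n * κ)
    (u : Fin p → ℝ) :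
    columnLik z j u * Real.exp (-ρ * ∑ k, |u k|) ≤
      penalizedLik z j ρ (fun k => θ k j) *
        Real.exp ((4608 / kappaCone θ).toReal * (ρ ^ 2 / (576 * n)) * colSparsity θ j) *
        Real.exp (-(ρ / 4 * ∑ k, |u k - θ k j|)) := by
  refine penalizedLik_le hz hρ j u ?_
  have hQ := logisticInfo_quadForm_nonneg (covariates z j) (fun l => θ l j) fun k => u k - θ k j
  have hsum := sum_abs_eq_add (fun k => θ k j) (fun k => u k - θ k j)
  have hB : 0 ≤ ∑ k with θ k j ≠ 0, |u k - θ k j| := Finset.sum_nonneg fun _ _ => abs_nonneg _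
  have hC : 0 ≤ ∑ k with θ k j = 0, |u k - θ k j| := Finset.sum_nonneg fun _ _ => abs_nonneg _
  have hBs := sq_sum_abs_le_card_mul (Finset.univ.filter fun k => θ k j ≠ 0) fun k => u k - θ k j
  have hE : 0 ≤ (4608 / kappaCone θ).toReal * (ρ ^ 2 / (576 * n)) * colSparsity θ j := by
    positivity
  rw [hsum]
  -- `kappaCone` may be ∞, whose `toReal` is 0. A nonzero direction in the cone excludes this, since
  -- Rayleigh quotients are finite.
  have hκr : ∀ d : Fin p → ℝ, d ≠ 0 →
      ∑ k with θ k j = 0, |d k| ≤ 7 * ∑ k with θ k j ≠ 0, |d k| →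
      kappaCone θ ≠ ⊤ ∧
      (kappaCone θ).toReal * ∑ k, d k ^ 2 ≤ ∑ k, ∑ l, fisher θ j k l * (d k * d l) := by
    intro d hd hc
    have h := kappaCone_le_rayleigh j hd hc
    exact ⟨ne_top_of_le_ne_top ENNReal.ofReal_ne_top h,
      toReal_mul_le_of_le_rayleigh ((ENNReal.ofReal_pos.2 hκ).trans_le hκc) hd h⟩
  have hhalf := fun (m κ : ℝ) => half_le_logisticInfo (d := fun k => u k - θ k j) (m := m) (κ := κ)
    hz j hr
  rw [hsum] at hhalf
  have hcard : ((Finset.univ.filter fun k => θ k j ≠ 0).card : ℝ) = colSparsity θ j := rfl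
  rw [hcard] at hBs
  set Q := ∑ k, ∑ l, logisticInfo (covariates z j) (fun l => θ l j) k l *
        ((u k - θ k j) * (u l - θ l j))
  have hx : 0 ≤ ∑ k, (u k - θ k j) ^ 2 := Finset.sum_nonneg fun _ _ => sq_nonneg _
  have hs0 : (0 : ℝ) ≤ colSparsity θ j := Nat.cast_nonneg _
  by_cases hcone : ∑ k with θ k j = 0, |u k - θ k j| ≤ 7 * ∑ k with θ k j ≠ 0, |u k - θ k j|
  · by_cases hd : (fun k => u k - θ k j) = 0
    · have h0 : ∀ k, u k - θ k j = 0 := fun k => congrFun hd k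
      simp only [h0, abs_zero, Finset.sum_const_zero, mul_zero, sub_zero, zero_sub]
      have : 0 ≤ Q / (2 + (0 + 0)) := by positivity
      linarith
    · obtain ⟨htop, hκ1⟩ := hκr _ hd hcone
      have hxpos := sum_sq_pos_of_ne_zero hd
      set B := ∑ k with θ k j ≠ 0, |u k - θ k j|
      set C := ∑ k with θ k j = 0, |u k - θ k j|
      set x2 := ∑ k, (u k - θ k j) ^ 2
      set s : ℝ := (colSparsity θ j : ℝ)
      have hκ2 : κ ≤ (kappaCone θ).toReal := (ENNReal.ofReal_le_iff_le_toReal htop).1 hκc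
      set K := (kappaCone θ).toReal
      have hK : 0 < K := hκ.trans_le hκ2
      have hn' : (0 : ℝ) < n := Nat.cast_pos.2 hn
      -- With empty support the cone condition forces C ≤ 0, hence a zero error.
      have hspos : 0 < s := by
        rcases hs0.eq_or_lt with h0 | h0
        · exfalso
          have hB0 : B = 0 := by
            rw [← h0, zero_mul] at hBs
            exact pow_eq_zero_iff (two_ne_zero) |>.1 (le_antisymm hBs (sq_nonneg _))
          have hsum0 : ∑ k, |u k - θ k j| = 0 := by
            rw [hsum]; linarith
          refine hd (funext fun k => ?_)
          have := (Finset.sum_eq_zero_iff_of_nonneg fun _ _ => abs_nonneg _).1 hsum0 k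
            (Finset.mem_univ k)
          simpa using this
        · exact h0
      have hnK : n * κ ≤ n * K := mul_le_mul_of_nonneg_left hκ2 hn'.le
      have hQ2 : n * K / 2 * x2 ≤ Q := by
        -- On the cone ‖d‖₁ ≤ 8B and B² ≤ s‖d‖₂², hence ‖d‖₁² ≤ 64 s‖d‖₂².
        refine hhalf (64 * s) K hκ1 ?_ (by linarith)
        have : (B + C) ^ 2 ≤ (8 * B) ^ 2 := pow_le_pow_left₀ (by linarith) (by linarith) 2
        nlinarith
      have hx2 : B ^ 2 / s ≤ x2 := by
        rw [div_le_iff₀ hspos]; linarith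
      have hQ3 : n * K * B ^ 2 / (4 * s * (1 + 4 * B)) ≤ Q / (2 + (B + C)) := by
        have h1 : n * K / 2 * (B ^ 2 / s) ≤ Q :=
          (mul_le_mul_of_nonneg_left hx2 (by positivity)).trans hQ2
        calc n * K * B ^ 2 / (4 * s * (1 + 4 * B)) = n * K / 2 * (B ^ 2 / s) / (2 + 8 * B) := by
              field_simp; ring
          _ ≤ Q / (2 + 8 * B) := by gcongr
          _ ≤ _ := div_le_div_of_nonneg_left hQ (by linarith) (by linarith)
      have hmain := cone_exponent_le hspos hB (mul_pos hn' hK) (hρs.trans hnK)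
      -- 4608 = 8 · 576, and ρ²/(576 n) = log p once ρ is the prior scale.
      have e : 8 * ρ ^ 2 * s / (n * K) =
          (4608 / kappaCone θ).toReal * (ρ ^ 2 / (576 * n)) * s := by
        rw [ENNReal.toReal_div]
        simp only [ENNReal.toReal_ofNat]
        change _ = 4608 / K * _ * _
        field_simp
        ring
      rw [← e]
      have h1 : 0 ≤ ρ * B := mul_nonneg hρ hB
      have h2 : 0 ≤ ρ * C := mul_nonneg hρ hC
      linarith
  -- Off the cone 7ρB/4 ≤ ρC/4, and the curvature term is nonnegative.
  · push Not at hcone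
    have h1 := mul_le_mul_of_nonneg_left hcone.le hρ
    have h2 : 0 ≤ Q / (2 + (∑ k with θ k j ≠ 0, |u k - θ k j| +
      ∑ k with θ k j = 0, |u k - θ k j|)) := by positivity
    linarith

/-- For y ≤ 2 the curvature is at least Mρy/192; it absorbs 2ρy ≤ Mρy/500 and still leaves Mq/400.
For y ≥ 2 it is at least my/(4s): one half absorbs 2ρy, the other is at least Mρ/192. -/
lemma sparse_exponent_le {ρ m s y M q : ℝ} (hρ : 0 ≤ ρ) (hs : 0 < s) (hy : 0 ≤ y) (hm : 0 < m)
    (hM : 1000 ≤ M) (h : 16 * ρ * s ≤ m) (hmy : M * s * ρ / 24 ≤ m * y) (hρy : q ≤ ρ * y)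
    (hρq : q ≤ ρ) :
    2 * ρ * y - m * y ^ 2 / (4 * s * (1 + y / 2)) ≤ - (M / 400 * q) := by
  rcases le_total y 2 with h2 | h2
  · have h1 : m * y ^ 2 / (8 * s) ≤ m * y ^ 2 / (4 * s * (1 + y / 2)) := by
      apply div_le_div_of_nonneg_left (by positivity) (by positivity)
      nlinarith
    have h3 : M * ρ * y / 192 ≤ m * y ^ 2 / (8 * s) := by
      rw [div_le_div_iff₀ (by norm_num) (by positivity)]
      have := mul_le_mul_of_nonneg_right hmy hy
      nlinarith
    have h4 : M * q ≤ M * (ρ * y) := mul_le_mul_of_nonneg_left hρy (by linarith)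
    have h5 : 1000 * (ρ * y) ≤ M * (ρ * y) := mul_le_mul_of_nonneg_right hM (by positivity)
    have h6 : 0 ≤ ρ * y := by positivity
    linarith
  · have h1 : m * y / (4 * s) ≤ m * y ^ 2 / (4 * s * (1 + y / 2)) := by
      rw [div_le_div_iff₀ (by positivity) (by positivity)]
      have : 0 ≤ m * y * s * (y - 2) := by
        have : 0 ≤ y - 2 := by linarith
        positivity
      nlinarith
    have h3 : 2 * ρ * y ≤ m * y / (8 * s) := by
      rw [le_div_iff₀ (by positivity)]
      nlinarith
    have h4 : M * ρ / 192 ≤ m * y / (8 * s) := by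
      rw [div_le_div_iff₀ (by norm_num) (by positivity)]
      nlinarith
    have e : m * y / (4 * s) = m * y / (8 * s) + m * y / (8 * s) := by field_simp; ring
    have h5 : M * q ≤ M * ρ := mul_le_mul_of_nonneg_left hρq (by linarith)
    have h6 : 0 ≤ M * ρ := by nlinarith
    linarith

/-- A b-sparse error satisfies ‖d‖₁ ≤ √b ‖d‖₂, so the curvature applies without a cone condition.
The hypotheses on M and q express that the error is beyond the contraction radius. -/
lemma penalizedLik_le_of_kappaSparse {θ : Matrix (Fin p) (Fin p) ℝ} {ρ r M q : ℝ}
    {z : Fin n → Fin p → Fin 2} (hz : RegularData θ (ρ / 2) r z) (hρ : 0 ≤ ρ) (hr : 0 ≤ r)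
    (hn : 0 < n) (j : Fin p) {b c : ℕ} (hb : 0 < b) (hbc : b ≤ c) (hκ : 0 < (kappaSparse θ c).toReal)
    (hM : 1000 ≤ M) {u : Fin p → ℝ} (hu : l0 (fun k => u k - θ k j) ≤ b)
    (hu0 : (fun k => u k - θ k j) ≠ 0)
    (hrb : 2 * (r * b) ≤ n * (kappaSparse θ c).toReal)
    (hρb : 16 * ρ * b ≤ n * (kappaSparse θ c).toReal)
    (hMu : M * b * ρ / 24 ≤
      n * (kappaSparse θ c).toReal * Real.sqrt (b * ∑ k, (u k - θ k j) ^ 2))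
    (hqu : q ≤ ρ * Real.sqrt (b * ∑ k, (u k - θ k j) ^ 2)) (hq : q ≤ ρ) :
    columnLik z j u * Real.exp (-ρ * ∑ k, |u k|) ≤
      penalizedLik z j ρ (fun k => θ k j) * Real.exp (-(M / 400 * q)) *
        Real.exp (-(ρ / 4 * ∑ k, |u k - θ k j|)) := by
  refine penalizedLik_le hz hρ j u ?_
  have hQ := logisticInfo_quadForm_nonneg (covariates z j) (fun l => θ l j) fun k => u k - θ k j
  have hsum := sum_abs_eq_add (fun k => θ k j) (fun k => u k - θ k j)
  have hC : 0 ≤ ∑ k with θ k j = 0, |u k - θ k j| := Finset.sum_nonneg fun _ _ => abs_nonneg _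
  have hN : 0 ≤ ∑ k, |u k - θ k j| := Finset.sum_nonneg fun _ _ => abs_nonneg _
  have hx : 0 ≤ ∑ k, (u k - θ k j) ^ 2 := Finset.sum_nonneg fun _ _ => sq_nonneg _
  have hb' : (0 : ℝ) < b := Nat.cast_pos.2 hb
  have hn' : (0 : ℝ) < n := Nat.cast_pos.2 hn
  have hNb : (∑ k, |u k - θ k j|) ^ 2 ≤ b * ∑ k, (u k - θ k j) ^ 2 :=
    (sq_sum_abs_le_l0_mul fun k => u k - θ k j).trans
      (mul_le_mul_of_nonneg_right (Nat.cast_le.2 hu) hx)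
  have hκ1 := toReal_mul_le_of_le_rayleigh (κ := kappaSparse θ c) (ENNReal.toReal_pos_iff.1 hκ).1 hu0
    (kappaSparse_le_rayleigh j hu0 (hu.trans hbc))
  have hQ2 := half_le_logisticInfo hz j hr hκ1 hNb hrb
  have hNy := Real.le_sqrt_of_sq_le hNb
  have hy0 := Real.sqrt_nonneg (b * ∑ k, (u k - θ k j) ^ 2)
  have hysq := Real.sq_sqrt (mul_nonneg hb'.le hx)
  have hmain := sparse_exponent_le hρ hb' hy0 (mul_pos hn' hκ) hM hρb hMu hqu hq
  set Q := ∑ k, ∑ l, logisticInfo (covariates z j) (fun l => θ l j) k l *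
        ((u k - θ k j) * (u l - θ l j))
  set K := (kappaSparse θ c).toReal
  set y := Real.sqrt (b * ∑ k, (u k - θ k j) ^ 2)
  set N := ∑ k, |u k - θ k j|
  have hQ3 : n * K * y ^ 2 / (4 * b * (1 + y / 2)) ≤ Q / (2 + N) := by
    calc n * K * y ^ 2 / (4 * b * (1 + y / 2))
        = (n * K / 2 * ∑ k, (u k - θ k j) ^ 2) / (2 + y) := by
          rw [hysq]
          field_simp
          ring
      _ ≤ Q / (2 + y) := by gcongr
      _ ≤ _ := div_le_div_of_nonneg_left hQ (by linarith) (by linarith)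
  have h1 : ρ * N ≤ ρ * y := mul_le_mul_of_nonneg_left hNy hρ
  have h2 := mul_nonneg hρ hC
  have h3 := mul_nonneg hρ hN
  have h4 : ρ * N = ρ * ∑ k with θ k j ≠ 0, |u k - θ k j| +
      ρ * ∑ k with θ k j = 0, |u k - θ k j| := by rw [hsum]; ring
  linarith

/-! ### Posterior probabilities of one column -/

lemma measurable_l0 : Measurable (l0 : (Fin p → ℝ) → ℕ) := by
  unfold l0
  simp_rw [Finset.card_filter]
  refine Finset.measurable_sum _ fun k _ => Measurable.ite ?_ measurable_const measurable_const
  exact (measurableSet_eq_fun (measurable_pi_apply k) measurable_const).compl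

lemma measurableSet_lt_l0 (a : ℝ) : MeasurableSet {u : Fin p → ℝ | a < l0 u} :=
  measurableSet_lt measurable_const ((measurable_of_countable fun m : ℕ => (m : ℝ)).comp measurable_l0)

lemma le_columnMass_univ {θ : Matrix (Fin p) (Fin p) ℝ} {π : Finset (Fin p) → ℝ} {ρ r : ℝ}
    {z : Fin n → Fin p → Fin 2} (hz : RegularData θ (ρ / 2) r z) (hρ : 0 < ρ) (j : Fin p) :
    ENNReal.ofReal (π (Finset.univ.filter fun k => θ k j ≠ 0)) *
      ENNReal.ofReal (penalizedLik z j ρ (fun k => θ k j) *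
      Real.exp (-(3 / 2 * colSparsity θ j + n * (colSparsity θ j) ^ 2 / (2 * ρ ^ 2)))) ≤
      columnMass π ρ z j Set.univ := by
  rw [columnMass, Measure.restrict_univ]
  refine le_lintegral_columnPrior hρ (measurable_columnLik z j) (v := fun k => θ k j)
    (fun k hk => by simpa using hk) fun u hu hu' => le_penalizedLik hz hρ j ?_ hu'
  exact fun k hk => hu k (by simpa using hk)

/-- The penalised likelihood at the truth occurs in both bounds and cancels, which leaves a
comparison of prior weights. -/
lemma columnMass_div_le {θ : Matrix (Fin p) (Fin p) ℝ} {π : Finset (Fin p) → ℝ} {ρ r : ℝ}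
    {z : Fin n → Fin p → Fin 2} (hz : RegularData θ (ρ / 2) r z) (hρ : 0 < ρ) (j : Fin p)
    (hπ : ∀ δ, 0 ≤ π δ) {B : Set (Fin p → ℝ)} (hB : MeasurableSet B) {K η : ℝ} (hK : 0 ≤ K)
    (h : ∀ u ∈ B, columnLik z j u * Real.exp (-ρ * ∑ k, |u k|) ≤
      penalizedLik z j ρ (fun k => θ k j) * K * Real.exp (-(ρ / 4 * ∑ k, |u k - θ k j|)))
    {A : Finset (Finset (Fin p))} (hA : ∀ δ, δ ∉ A → slabMeasure δ B = 0) (hη : 0 ≤ η)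
    (hle : K * ∑ δ ∈ A, π δ * 4 ^ δ.card ≤
      η * (π (Finset.univ.filter fun k => θ k j ≠ 0) *
      Real.exp (-(3 / 2 * colSparsity θ j + n * (colSparsity θ j) ^ 2 / (2 * ρ ^ 2))))) :
    columnMass π ρ z j B / columnMass π ρ z j Set.univ ≤ ENNReal.ofReal η := by
  have hW := penalizedLik_pos z j ρ fun k => θ k j
  refine ENNReal.div_le_of_le_mul ?_
  refine (setLIntegral_columnPrior_le hπ hρ (measurable_columnLik z j) hB (mul_nonneg hW.le hK)
    (fun k => θ k j) h A hA).trans ?_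
  refine le_trans ?_ (mul_le_mul_right (le_columnMass_univ hz hρ j) _)
  rw [← ENNReal.ofReal_mul (hπ _), ← ENNReal.ofReal_mul hη]
  refine ENNReal.ofReal_le_ofReal ?_
  have := mul_le_mul_of_nonneg_left hle hW.le
  linarith

/-! ### Consequences of the growth conditions on the sparsity prior -/

section Prior

variable {c₁ c₂ c₃ c₄ : ℝ} {g : ℕ → ℝ}

/-- The slab factor 4^t is paid for step by step by the decay ratio of g. -/
lemma prior_add_le {β : ℝ} (h0 : ∀ s ≤ p, 0 ≤ g s)
    (hg : ∀ s, 1 ≤ s → s ≤ p → g s ≤ c₂ / (p : ℝ) ^ c₄ * g (s - 1))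
    (hβ : 4 * (c₂ / (p : ℝ) ^ c₄) ≤ Real.exp (-β)) (s d : ℕ) (hsd : s + d ≤ p) :
    g (s + d) * 4 ^ (s + d) ≤ Real.exp (-(β * d)) * (4 ^ s * g s) := by
  induction d with
  | zero => simp [mul_comm]
  | succ d ih =>
    have h1 := hg (s + d + 1) (by omega) (by omega)
    have h2 := ih (by omega)
    have h3 := h0 (s + d) (by omega)
    rw [Nat.add_sub_cancel] at h1
    calc g (s + (d + 1)) * 4 ^ (s + (d + 1)) ≤ (c₂ / (p : ℝ) ^ c₄ * g (s + d)) * 4 ^ (s + (d + 1)) :=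
          mul_le_mul_of_nonneg_right h1 (by positivity)
      _ = 4 * (c₂ / (p : ℝ) ^ c₄) * (g (s + d) * 4 ^ (s + d)) := by ring
      _ ≤ Real.exp (-β) * (Real.exp (-(β * d)) * (4 ^ s * g s)) :=
          mul_le_mul hβ h2 (by positivity) (Real.exp_pos _).le
      _ = _ := by
          rw [← mul_assoc, ← Real.exp_add]
          congr 2
          push_cast
          ring

lemma le_prior {γ : ℝ} (h0 : ∀ s ≤ p, 0 ≤ g s)
    (hg : ∀ s, 1 ≤ s → s ≤ p → c₁ / (p : ℝ) ^ c₃ * g (s - 1) ≤ g s)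
    (hγ : Real.exp (-γ) ≤ c₁ / (p : ℝ) ^ c₃) (s : ℕ) (hs : s ≤ p) :
    Real.exp (-(γ * s)) * g 0 ≤ g s := by
  induction s with
  | zero => simp
  | succ s ih =>
    have h1 := hg (s + 1) (by omega) hs
    have h2 := ih (by omega)
    rw [Nat.add_sub_cancel] at h1
    calc Real.exp (-(γ * (s + 1 : ℕ))) * g 0 = Real.exp (-γ) * (Real.exp (-(γ * s)) * g 0) := by
          rw [← mul_assoc, ← Real.exp_add]
          congr 2
          push_cast
          ring
      _ ≤ Real.exp (-γ) * g s := mul_le_mul_of_nonneg_left h2 (Real.exp_pos _).le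
      _ ≤ c₁ / (p : ℝ) ^ c₃ * g s := mul_le_mul_of_nonneg_right hγ (h0 s (by omega))
      _ ≤ _ := h1

lemma sum_prior_tail_le {β a : ℝ} (hβ0 : 0 ≤ β) (h0 : ∀ s ≤ p, 0 ≤ g s)
    (hg : ∀ s, 1 ≤ s → s ≤ p → g s ≤ c₂ / (p : ℝ) ^ c₄ * g (s - 1))
    (hβ : 4 * (c₂ / (p : ℝ) ^ c₄) ≤ Real.exp (-β)) {s : ℕ} (hsp : s ≤ p) (hs : (s : ℝ) ≤ a) :
    ∑ t ∈ (Finset.range (p + 1)).filter (fun t : ℕ => a < (t : ℝ)), g t * 4 ^ t ≤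
      p * (Real.exp (-(β * (a - s))) * (4 ^ s * g s)) := by
  have hgs := h0 s hsp
  calc _ ≤ ∑ t ∈ (Finset.range (p + 1)).filter (fun t : ℕ => a < (t : ℝ)),
        Real.exp (-(β * (a - s))) * (4 ^ s * g s) := by
        refine Finset.sum_le_sum fun t ht => ?_
        obtain ⟨ht1, ht2⟩ := Finset.mem_filter.1 ht
        have hst : s ≤ t := by exact_mod_cast (hs.trans ht2.le)
        obtain ⟨d, rfl⟩ := Nat.exists_eq_add_of_le hst
        refine (prior_add_le h0 hg hβ s d (Nat.lt_succ_iff.1 (Finset.mem_range.1 ht1))).trans ?_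
        refine mul_le_mul_of_nonneg_right (Real.exp_le_exp.2 ?_) (by positivity)
        push_cast at ht2
        have : β * (a - s) ≤ β * d := mul_le_mul_of_nonneg_left (by linarith) hβ0
        linarith
    _ ≤ _ := by
        rw [Finset.sum_const, nsmul_eq_mul]
        refine mul_le_mul_of_nonneg_right ?_ (by positivity)
        -- Since t > a ≥ 0, the index 0 is excluded and at most p terms remain.
        have : ((Finset.range (p + 1)).filter (fun t : ℕ => a < (t : ℝ))).card ≤
            (Finset.Icc 1 p).card := by
          refine Finset.card_le_card fun t ht => ?_
          obtain ⟨ht1, ht2⟩ := Finset.mem_filter.1 ht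
          have h1 : (0 : ℝ) < t := lt_of_le_of_lt ((Nat.cast_nonneg s).trans hs) ht2
          have h2 : 0 < t := by exact_mod_cast h1
          rw [Finset.mem_range] at ht1
          rw [Finset.mem_Icc]
          omega
        rw [Nat.card_Icc, Nat.add_sub_cancel] at this
        exact_mod_cast this

lemma sum_prior_le {β : ℝ} (hβ0 : 0 ≤ β) (h0 : ∀ s ≤ p, 0 ≤ g s)
    (hg : ∀ s, 1 ≤ s → s ≤ p → g s ≤ c₂ / (p : ℝ) ^ c₄ * g (s - 1))
    (hβ : 4 * (c₂ / (p : ℝ) ^ c₄) ≤ Real.exp (-β)) :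
    ∑ t ∈ Finset.range (p + 1), g t * 4 ^ t ≤ (p + 1) * g 0 := by
  calc _ ≤ ∑ t ∈ Finset.range (p + 1), g 0 := by
        refine Finset.sum_le_sum fun t ht => ?_
        have h := prior_add_le h0 hg hβ 0 t (by rw [Finset.mem_range] at ht; omega)
        rw [zero_add] at h
        refine h.trans ?_
        rw [pow_zero, one_mul]
        refine mul_le_of_le_one_left (h0 0 (Nat.zero_le p)) (Real.exp_le_one_iff.2 ?_)
        have : 0 ≤ β * t := by positivity
        linarith
    _ = _ := by simp

/-- The total mass 1 is at most (p + 1) g 0. -/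
lemma prior_zero_pos {β : ℝ} (hβ0 : 0 ≤ β) (h0 : ∀ s ≤ p, 0 ≤ g s)
    (hsum : ∑ s ∈ Finset.range (p + 1), g s = 1)
    (hg : ∀ s, 1 ≤ s → s ≤ p → g s ≤ c₂ / (p : ℝ) ^ c₄ * g (s - 1))
    (hβ : 4 * (c₂ / (p : ℝ) ^ c₄) ≤ Real.exp (-β)) : 0 < g 0 := by
  have h1 := sum_prior_le hβ0 h0 hg hβ
  have h2 : ∑ s ∈ Finset.range (p + 1), g s ≤ ∑ t ∈ Finset.range (p + 1), g t * 4 ^ t := by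
    refine Finset.sum_le_sum fun t ht => ?_
    refine le_mul_of_one_le_right (h0 t (by rw [Finset.mem_range] at ht; omega))
      (one_le_pow₀ (by norm_num))
  rw [hsum] at h2
  have h3 : (0 : ℝ) < p + 1 := by positivity
  exact pos_of_mul_pos_right (by linarith : 0 < (p + 1) * g 0) h3.le

lemma exp_neg_mul_log_le_inv_choose (hp : 0 < p) (s : ℕ) {a : ℝ} (ha : 0 ≤ a) (hs : s ≤ p) :
    Real.exp (-(s * Real.log p)) * a ≤ a / (p.choose s : ℝ) := by
  have hc : (0 : ℝ) < p.choose s := Nat.cast_pos.2 (Nat.choose_pos hs)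
  have hp' : (0 : ℝ) < p := Nat.cast_pos.2 hp
  have h1 : (p.choose s : ℝ) ≤ Real.exp (s * Real.log p) := by
    rw [Real.exp_nat_mul, Real.exp_log hp']
    exact_mod_cast Nat.choose_le_pow p s
  rw [le_div_iff₀ hc]
  calc Real.exp (-(s * Real.log p)) * a * p.choose s
      ≤ Real.exp (-(s * Real.log p)) * a * Real.exp (s * Real.log p) :=
        mul_le_mul_of_nonneg_left h1 (by positivity)
    _ = a := by
      rw [mul_right_comm, ← Real.exp_add]
      simp

end Prior

/-! ### Sparsity levels and sample size -/

lemma colSparsity_le (θ : Matrix (Fin p) (Fin p) ℝ) (j : Fin p) : colSparsity θ j ≤ p :=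
  (Finset.card_le_univ (Finset.univ.filter fun k => θ k j ≠ 0)).trans_eq (Fintype.card_fin p)

section Levels

variable {c₄ : ℝ} {θ : Matrix (Fin p) (Fin p) ℝ}

lemma zeta_eq (j : Fin p) :
    zeta c₄ θ j = colSparsity θ j + 1 / c₄ * (4 + 2 * (1 + (4608 / kappaCone θ).toReal +
      colSparsity θ j / (64 * Real.log p ^ 2) + (Real.log 4 + 1) / Real.log p) *
        colSparsity θ j) := by
  have h : Real.log (4 * Real.exp 1) = Real.log 4 + 1 := by
    rw [Real.log_mul (by norm_num) (Real.exp_pos 1).ne', Real.log_exp]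
  rw [zeta, h]
  ring

lemma le_zeta (hc : 0 < c₄) (hL : 0 < Real.log p) (j : Fin p) :
    colSparsity θ j + 1 / c₄ * (4 + (colSparsity θ j : ℝ) ^ 2 / (32 * Real.log p ^ 2)) ≤
      zeta c₄ θ j := by
  rw [zeta_eq]
  have h4 : 0 < Real.log 4 := Real.log_pos (by norm_num)
  have h1 : 0 ≤ (4608 / kappaCone θ).toReal := ENNReal.toReal_nonneg
  have hs : (0 : ℝ) ≤ colSparsity θ j := Nat.cast_nonneg _
  set s : ℝ := (colSparsity θ j : ℝ)
  set L := Real.log p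
  have h2 : 0 ≤ (Real.log 4 + 1) / L := by positivity
  have e : s ^ 2 / (32 * L ^ 2) = 2 * (s / (64 * L ^ 2)) * s := by
    field_simp; ring
  have h5 : s ^ 2 / (32 * L ^ 2) ≤
      2 * (1 + (4608 / kappaCone θ).toReal + s / (64 * L ^ 2) + (Real.log 4 + 1) / L) * s := by
    rw [e]
    refine mul_le_mul_of_nonneg_right ?_ hs
    linarith
  have h6 : 0 ≤ 1 / c₄ := by positivity
  have := mul_le_mul_of_nonneg_left h5 h6
  linarith

lemma le_sbar (j : Fin p) : (colSparsity θ j : ℝ) + zeta c₄ θ j ≤ sbar c₄ θ j := Nat.le_ceil _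

lemma colSparsity_le_zeta (hc : 0 < c₄) (hL : 0 < Real.log p) (j : Fin p) :
    (colSparsity θ j : ℝ) ≤ zeta c₄ θ j := by
  have := le_zeta (θ := θ) hc hL j
  have : 0 ≤ 1 / c₄ * (4 + (colSparsity θ j : ℝ) ^ 2 / (32 * Real.log p ^ 2)) := by positivity
  linarith

lemma one_le_sbar (hc : 0 < c₄) (hL : 0 < Real.log p) (j : Fin p) : 1 ≤ sbar c₄ θ j := by
  rw [Nat.one_le_iff_ne_zero, ← Nat.pos_iff_ne_zero]
  have h1 := le_zeta (θ := θ) hc hL j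
  have h2 := le_sbar (c₄ := c₄) (θ := θ) j
  have h3 : 0 < 1 / c₄ * (4 + (colSparsity θ j : ℝ) ^ 2 / (32 * Real.log p ^ 2)) := by positivity
  have h4 : (0 : ℝ) ≤ colSparsity θ j := Nat.cast_nonneg _
  have : (0 : ℝ) < sbar c₄ θ j := by linarith
  exact_mod_cast this

lemma colSparsity_le_sbar (hc : 0 < c₄) (hL : 0 < Real.log p) (j : Fin p) :
    (colSparsity θ j : ℝ) ≤ sbar c₄ θ j := by
  have h1 := colSparsity_le_zeta (θ := θ) hc hL j
  have h2 := le_sbar (c₄ := c₄) (θ := θ) j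
  have h4 : (0 : ℝ) ≤ colSparsity θ j := Nat.cast_nonneg _
  linarith

/-- This uses the summand s/(64 (log p)²) of `zeta`; it controls the second-order cost s²/(1152 log
p) of the box. -/
lemma sq_colSparsity_le (hc : 0 < c₄) (hL : 0 < Real.log p) (j : Fin p) :
    (colSparsity θ j : ℝ) ^ 2 ≤ 32 * c₄ * Real.log p ^ 2 * sbar c₄ θ j := by
  have h1 := le_zeta (θ := θ) hc hL j
  have h2 := le_sbar (c₄ := c₄) (θ := θ) j
  have h4 : (0 : ℝ) ≤ colSparsity θ j := Nat.cast_nonneg _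
  set s : ℝ := (colSparsity θ j : ℝ)
  set L := Real.log p
  have h5 : 1 / c₄ * (s ^ 2 / (32 * L ^ 2)) ≤ sbar c₄ θ j := by
    have : 0 ≤ 1 / c₄ * 4 := by positivity
    linarith
  have e : 1 / c₄ * (s ^ 2 / (32 * L ^ 2)) = s ^ 2 / (32 * c₄ * L ^ 2) := by
    field_simp
  rw [e, div_le_iff₀ (by positivity)] at h5
  linarith

lemma sbar_le_sum (j : Fin p) : (sbar c₄ θ j : ℝ) ≤ ∑ j, (sbar c₄ θ j : ℝ) :=
  Finset.single_le_sum (f := fun j => (sbar c₄ θ j : ℝ)) (fun _ _ => Nat.cast_nonneg _)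
    (Finset.mem_univ j)

lemma sbar_le_sbarMax (j : Fin p) : sbar c₄ θ j ≤ sbarMax c₄ θ :=
  Finset.le_sup (f := sbar c₄ θ) (Finset.mem_univ j)

lemma kappa_le_one (hc : 0 < c₄) (hL : 0 < Real.log p) (j : Fin p) : kappa c₄ θ ≤ 1 :=
  (min_le_right _ _).trans
    (kappaSparse_le_one ((one_le_sbar hc hL j).trans (sbar_le_sbarMax j)) j)

end Levels

lemma priorScale_sq :
    priorScale n p ^ 2 = 576 * (n * Real.log p) := by
  rw [priorScale, mul_pow, Real.sq_sqrt (by positivity)]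
  norm_num

/-- The sample size condition in the form used by the column bounds. -/
lemma priorScale_mul_le {S κ : ℝ} (hS : 0 ≤ S) (hκ : 0 < κ)
    (h : 10 ^ 7 * (S / κ) ^ 2 * Real.log p ≤ n) : 64 * priorScale n p * S ≤ n * κ := by
  have hρ : 0 ≤ priorScale n p := by rw [priorScale]; positivity
  have hn : (0 : ℝ) ≤ n := Nat.cast_nonneg n
  have h1 : 10 ^ 7 * S ^ 2 * Real.log p ≤ n * κ ^ 2 := by
    have e : 10 ^ 7 * (S / κ) ^ 2 * Real.log p = 10 ^ 7 * S ^ 2 * Real.log p / κ ^ 2 := by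
      field_simp
    rwa [e, div_le_iff₀ (by positivity)] at h
  -- After squaring, the requirement is 64² · 576 = 2359296 ≤ 10⁷.
  refine (pow_le_pow_iff_left₀ (by positivity) (by positivity) two_ne_zero).1 ?_
  have e : (64 * priorScale n p * S) ^ 2 = 4096 * 576 * (n * Real.log p) * S ^ 2 := by
    rw [mul_pow, mul_pow, priorScale_sq]; ring
  rw [e]
  have h2 := mul_le_mul_of_nonneg_left h1 hn
  have h3 : 0 ≤ n * (S ^ 2 * Real.log p) := by positivity
  nlinarith

/-! ### Posterior concentration on regular data -/

section Column

variable {c₁ c₂ c₃ c₄ : ℝ} {π : Finset (Fin p) → ℝ} {θ : Matrix (Fin p) (Fin p) ℝ} {r κ : ℝ}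
  {z : Fin n → Fin p → Fin 2}

lemma SparsityPrior.nonneg (hπ : SparsityPrior c₁ c₂ c₃ c₄ p π) (δ : Finset (Fin p)) :
    0 ≤ π δ := by
  obtain ⟨g, h0, -, -, hg⟩ := hπ
  rw [hg]
  exact div_nonneg (h0 _ (by simpa using Finset.card_le_univ δ)) (Nat.cast_nonneg _)

lemma penalty_exponent_eq (hL : 0 < Real.log p) (hn : 0 < n) (s : ℝ) :
    n * s ^ 2 / (2 * priorScale n p ^ 2) = s ^ 2 / (1152 * Real.log p) := by
  have hn' : (0 : ℝ) < n := Nat.cast_pos.2 hn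
  rw [priorScale_sq]
  field_simp
  ring

/-- The quasi-posterior probability that a column has more than `zeta` nonzero entries. -/
lemma columnMass_dense_div_le (hc₄ : 0 < c₄) (hπ : SparsityPrior c₁ c₂ c₃ c₄ p π)
    (hL : 0 < Real.log p) (hp : 0 < p)
    (hβ : 4 * (c₂ / (p : ℝ) ^ c₄) ≤ Real.exp (-(3 / 4 * c₄ * Real.log p)))
    (hz : RegularData θ (priorScale n p / 2) r z) (hr : 0 ≤ r) (hn : 0 < n) (hκ : 0 < κ)
    (hκc : ENNReal.ofReal κ ≤ kappaCone θ) (j : Fin p)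
    (hrs : 128 * r * colSparsity θ j ≤ n * κ)
    (hρs : 64 * priorScale n p * colSparsity θ j ≤ n * κ) :
    columnMass π (priorScale n p) z j {u | zeta c₄ θ j < l0 u} /
      columnMass π (priorScale n p) z j Set.univ ≤
      ENNReal.ofReal (Real.exp (-(2 * Real.log p))) := by
  have hn' : (0 : ℝ) < n := Nat.cast_pos.2 hn
  have hρ : 0 < priorScale n p := by rw [priorScale]; positivity
  have hpos := hπ.nonneg
  obtain ⟨g, h0, -, hg, hgπ⟩ := hπ
  have hsp := colSparsity_le θ j
  refine columnMass_div_le hz hρ j hpos (measurableSet_lt_l0 _) (Real.exp_pos _).le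
    (fun u _ => penalizedLik_le_of_kappaCone hz hρ.le hr hn hκ hκc j hrs hρs u)
    (A := Finset.univ.filter fun δ => zeta c₄ θ j < ((δ.card : ℕ) : ℝ)) (fun δ hδ => ?_)
    (Real.exp_pos _).le ?_
  · exact slabMeasure_lt_l0 (by simpa using hδ)
  · rw [sum_prior_card hgπ fun t : ℕ => zeta c₄ θ j < (t : ℝ)]
    have htail := sum_prior_tail_le (by positivity) h0 (fun s h1 h2 => (hg s h1 h2).2) hβ hsp
      (colSparsity_le_zeta (θ := θ) hc₄ hL j)
    have hch := exp_neg_mul_log_le_inv_choose hp (colSparsity θ j) (h0 _ hsp) hsp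
    have hcard : (Finset.univ.filter fun k => θ k j ≠ 0).card = colSparsity θ j := rfl
    rw [hgπ, hcard, penalty_exponent_eq hL hn, priorScale_sq]
    refine (mul_le_mul_of_nonneg_left htail (Real.exp_pos _).le).trans ?_
    refine le_trans ?_ (mul_le_mul_of_nonneg_left (mul_le_mul_of_nonneg_right hch
      (Real.exp_pos _).le) (Real.exp_pos _).le)
    have hs0 : (0 : ℝ) ≤ colSparsity θ j := Nat.cast_nonneg _
    have hgs := h0 _ hsp
    have hζ := zeta_eq (c₄ := c₄) (θ := θ) j
    have hk : 0 ≤ (4608 / kappaCone θ).toReal := ENNReal.toReal_nonneg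
    have h4 : (4 : ℝ) ^ colSparsity θ j = Real.exp (colSparsity θ j * Real.log 4) := by
      rw [Real.exp_nat_mul, Real.exp_log (by norm_num)]
    have hpe : (p : ℝ) = Real.exp (Real.log p) := (Real.exp_log (Nat.cast_pos.2 hp)).symm
    rw [h4]
    -- The decay 3c₄/4 · log p times `zeta` - s yields 3 log p, which pays for the factor p and the
    -- target p⁻², and 3/2 of each bracketed term of `zeta` (scaled by s log p). These pay for the
    -- binomial coefficient, the cone exponent, the second-order cost, 4^s and the cost 3s/2 of the
    -- box.
    have key : (4608 / kappaCone θ).toReal * (576 * (n * Real.log p) / (576 * n)) *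
          colSparsity θ j + (Real.log p + (-(3 / 4 * c₄ * Real.log p *
          (zeta c₄ θ j - colSparsity θ j)) + colSparsity θ j * Real.log 4)) ≤
        -(2 * Real.log p) + (-(colSparsity θ j * Real.log p) +
          -(3 / 2 * colSparsity θ j + (colSparsity θ j : ℝ) ^ 2 / (1152 * Real.log p))) := by
      rw [hζ]
      set s : ℝ := (colSparsity θ j : ℝ)
      set k := (4608 / kappaCone θ).toReal
      set L := Real.log p
      have h4' : 0 < Real.log 4 := Real.log_pos (by norm_num)
      have e1 : 576 * (n * L) / (576 * n) = L := by field_simp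
      have e2 : 3 / 4 * c₄ * L * (s + 1 / c₄ * (4 + 2 * (1 + k + s / (64 * L ^ 2) +
          (Real.log 4 + 1) / L) * s) - s) = 3 * L + 3 / 2 * (L * s) + 3 / 2 * (k * L * s) +
          3 / 128 * (s ^ 2 / L) + 3 / 2 * (s * Real.log 4) + 3 / 2 * s := by
        field_simp
        ring
      have e3 : s ^ 2 / (1152 * L) = 1 / 1152 * (s ^ 2 / L) := by
        field_simp
      rw [e1, e2, e3]
      have i1 : 0 ≤ s ^ 2 / L := by positivity
      have i2 : 0 ≤ L * s := by positivity
      have i3 : 0 ≤ k * L * s := by positivity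
      have i4 : 0 ≤ s * Real.log 4 := by positivity
      linarith
    have key2 := mul_le_mul_of_nonneg_right (Real.exp_le_exp.2 key) hgs
    simp only [Real.exp_add] at key2
    rw [← hpe] at key2
    linarith

/-- The quasi-posterior probability that a column is sparse but far from the truth. -/
lemma columnMass_far_div_le (hc₃ : 0 < c₃) (hc₄ : 0 < c₄) (hπ : SparsityPrior c₁ c₂ c₃ c₄ p π)
    (hL : 1 ≤ Real.log p) (hp : 2 ≤ p)
    (hβ : 4 * (c₂ / (p : ℝ) ^ c₄) ≤ Real.exp (-(3 / 4 * c₄ * Real.log p)))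
    (hγ : Real.exp (-((c₃ + 1) * Real.log p)) ≤ c₁ / (p : ℝ) ^ c₃)
    (hz : RegularData θ (priorScale n p / 2) r z) (hr : 0 ≤ r) (hn : 0 < n)
    (hκ : 0 < (kappaSparse θ (sbarMax c₄ θ)).toReal)
    (hκ1 : (kappaSparse θ (sbarMax c₄ θ)).toReal ≤ 1) (j : Fin p) {M : ℝ}
    (hM : 1000 + 400 * (8 + c₃ + c₄) ≤ M)
    (hrb : 2 * (r * sbar c₄ θ j) ≤ n * (kappaSparse θ (sbarMax c₄ θ)).toReal)
    (hρb : 64 * priorScale n p * sbar c₄ θ j ≤ n * (kappaSparse θ (sbarMax c₄ θ)).toReal) :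
    columnMass π (priorScale n p) z j {u | ¬ zeta c₄ θ j < l0 u ∧
        (M / (kappaSparse θ (sbarMax c₄ θ)).toReal) ^ 2 * (sbar c₄ θ j * Real.log p / n) <
          ∑ k, (u k - θ k j) ^ 2} /
      columnMass π (priorScale n p) z j Set.univ ≤
      ENNReal.ofReal (Real.exp (-(2 * Real.log p))) := by
  have hL0 : 0 < Real.log p := by linarith
  have hp0 : 0 < p := by omega
  have hn' : (0 : ℝ) < n := Nat.cast_pos.2 hn
  have hρ : 0 < priorScale n p := by rw [priorScale]; positivity
  have hpos := hπ.nonneg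
  obtain ⟨g, h0, -, hg, hgπ⟩ := hπ
  have hsp := colSparsity_le θ j
  have hb := one_le_sbar (θ := θ) hc₄ hL0 j
  have hb1 : (1 : ℝ) ≤ sbar c₄ θ j := by exact_mod_cast hb
  have hρ2 := priorScale_sq (n := n) (p := p)
  have hM0 : 0 < M := by linarith
  refine columnMass_div_le hz hρ j hpos ?_ (K := Real.exp (-(M / 400 * (sbar c₄ θ j * Real.log p))))
    (Real.exp_pos _).le (fun u hu => ?_) (A := Finset.univ) (fun δ hδ => absurd (Finset.mem_univ δ) hδ)
    (Real.exp_pos _).le ?_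
  · refine MeasurableSet.inter (measurableSet_lt_l0 _).compl
      (measurableSet_lt (f := fun _ : Fin p → ℝ => _)
        (g := fun u : Fin p → ℝ => ∑ k, (u k - θ k j) ^ 2) measurable_const ?_)
    exact Finset.measurable_sum _ fun k _ => ((measurable_pi_apply k).sub_const _).pow_const 2
  · obtain ⟨hu1, hu2⟩ := hu
    rw [not_lt] at hu1
    set K := (kappaSparse θ (sbarMax c₄ θ)).toReal
    set b : ℝ := (sbar c₄ θ j : ℝ)
    set L := Real.log p
    set ρ := priorScale n p
    set y := Real.sqrt (b * ∑ k, (u k - θ k j) ^ 2)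
    have hy0 : 0 ≤ y := Real.sqrt_nonneg _
    have hy2 : y ^ 2 = b * ∑ k, (u k - θ k j) ^ 2 :=
      Real.sq_sqrt (mul_nonneg (by linarith) (Finset.sum_nonneg fun _ _ => sq_nonneg _))
    have hy3 : (M / K) ^ 2 * (b * L / n) * b ≤ y ^ 2 := by
      rw [hy2, mul_comm b (∑ k, _)]
      exact mul_le_mul_of_nonneg_right hu2.le (zero_le_one.trans hb1)
    -- The distance condition multiplied by √b, with ρ/24 = √(n log p).
    have hMy : M * b * ρ / 24 ≤ n * K * y := by
      refine (pow_le_pow_iff_left₀ (by positivity) (by positivity) two_ne_zero).1 ?_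
      have e : (M * b * ρ / 24) ^ 2 = (n * K) ^ 2 * ((M / K) ^ 2 * (b * L / n) * b) := by
        rw [div_pow, mul_pow, hρ2]
        field_simp
        norm_num
      rw [e, mul_pow (n * K) y]
      exact mul_le_mul_of_nonneg_left hy3 (by positivity)
    have hqy : b * L ≤ ρ * y := by
      have h1 := mul_le_mul_of_nonneg_right hMy hρ.le
      have e : M * b * ρ / 24 * ρ = 24 * M * (b * L) * n := by
        have : M * b * ρ / 24 * ρ = M * b * ρ ^ 2 / 24 := by ring
        rw [this, hρ2]
        ring
      rw [e] at h1
      have h2 : 24 * M * (b * L) ≤ K * (ρ * y) := by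
        refine le_of_mul_le_mul_right ?_ hn'
        linarith
      have h3 : K * (ρ * y) ≤ ρ * y := mul_le_of_le_one_left (by positivity) hκ1
      have h4 : b * L ≤ 24 * M * (b * L) := le_mul_of_one_le_left (by positivity) (by linarith)
      linarith
    have hqρ : b * L ≤ ρ := by
      have h1 := mul_le_mul_of_nonneg_right hρb hρ.le
      have e : 64 * ρ * b * ρ = 36864 * (b * L) * n := by
        have : 64 * ρ * b * ρ = 64 * b * ρ ^ 2 := by ring
        rw [this, hρ2]
        ring
      rw [e] at h1
      have h2 : 36864 * (b * L) ≤ K * ρ := by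
        refine le_of_mul_le_mul_right ?_ hn'
        linarith
      have h3 : K * ρ ≤ ρ := mul_le_of_le_one_left hρ.le hκ1
      have h4 : 0 ≤ b * L := by positivity
      linarith
    refine penalizedLik_le_of_kappaSparse hz hρ.le hr hn j (b := sbar c₄ θ j) hb
      (sbar_le_sbarMax j) hκ (by linarith) ?_ ?_ hrb ?_ hMy hqy hqρ
    -- The support of the error lies in the union of the two supports; hence s + `zeta` in the
    -- definition of `sbar`.
    · have h1 : l0 (fun k => u k - θ k j) ≤ l0 u + colSparsity θ j := by
        refine (Finset.card_le_card ?_).trans (Finset.card_union_le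
          (Finset.univ.filter fun k => u k ≠ 0) (Finset.univ.filter fun k => θ k j ≠ 0))
        intro k hk
        simp only [Finset.mem_filter, Finset.mem_univ, true_and, Finset.mem_union] at hk ⊢
        by_contra hcon
        push Not at hcon
        exact hk (by rw [hcon.1, hcon.2, sub_zero])
      have h2 := le_sbar (c₄ := c₄) (θ := θ) j
      have h3 : ((l0 u + colSparsity θ j : ℕ) : ℝ) ≤ sbar c₄ θ j := by
        push_cast
        linarith
      exact h1.trans (by exact_mod_cast h3)
    · intro h
      have h1 : ∀ k, u k - θ k j = 0 := fun k => congrFun h k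
      simp only [h1] at hu2
      have : 0 ≤ (M / K) ^ 2 * (b * L / n) := by positivity
      norm_num at hu2
      linarith
    · have : 0 ≤ ρ * b := by positivity
      linarith
  · have hs := sum_prior_card hgπ fun _ : ℕ => True
    simp only [Finset.filter_true] at hs
    rw [hs]
    have hcard : (Finset.univ.filter fun k => θ k j ≠ 0).card = colSparsity θ j := rfl
    have hub := sum_prior_le (by positivity) h0 (fun s h1 h2 => (hg s h1 h2).2) hβ
    have hg0 := h0 0 (Nat.zero_le p)
    have hlow := le_prior h0 (fun s h1 h2 => (hg s h1 h2).1) hγ _ hsp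
    have hch := exp_neg_mul_log_le_inv_choose hp0 (colSparsity θ j) (h0 _ hsp) hsp
    rw [hgπ, hcard, penalty_exponent_eq hL0 hn]
    refine (mul_le_mul_of_nonneg_left hub (Real.exp_pos _).le).trans ?_
    refine le_trans ?_ (mul_le_mul_of_nonneg_left (mul_le_mul_of_nonneg_right
      ((mul_le_mul_of_nonneg_left hlow (Real.exp_pos _).le).trans hch)
      (Real.exp_pos _).le) (Real.exp_pos _).le)
    have hpe : (p : ℝ) + 1 ≤ Real.exp (2 * Real.log p) := by
      have h2 : (2 : ℝ) ≤ p := by exact_mod_cast hp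
      have : Real.exp (2 * Real.log p) = (p : ℝ) ^ 2 := by
        rw [mul_comm, Real.exp_mul, Real.exp_log (by linarith)]
        norm_cast
      rw [this]
      nlinarith
    have hsq := sq_colSparsity_le (θ := θ) hc₄ hL0 j
    have hsb := colSparsity_le_sbar (θ := θ) hc₄ hL0 j
    have hs0 : (0 : ℝ) ≤ colSparsity θ j := Nat.cast_nonneg _
    -- In units of `sbar` log p the costs are at most 4 (the factor p + 1 and the target p⁻²), 1
    -- (binomial), c₃ + 1 (lower growth bound on g), 3/2 and c₄ (box), a total below 8 + c₃ + c₄.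
    have key : -(M / 400 * (sbar c₄ θ j * Real.log p)) + 2 * Real.log p ≤
        -(2 * Real.log p) + (-(colSparsity θ j * Real.log p) +
          -((c₃ + 1) * Real.log p * colSparsity θ j) +
          -(3 / 2 * colSparsity θ j + (colSparsity θ j : ℝ) ^ 2 / (1152 * Real.log p))) := by
      set s : ℝ := (colSparsity θ j : ℝ)
      set b : ℝ := (sbar c₄ θ j : ℝ)
      set L := Real.log p
      have i1 : s ^ 2 / (1152 * L) ≤ c₄ * (b * L) := by
        rw [div_le_iff₀ (by positivity)]
        have : 0 ≤ c₄ * L ^ 2 * b := by positivity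
        nlinarith
      have i2 : s * L ≤ b * L := mul_le_mul_of_nonneg_right hsb hL0.le
      have i3 : s ≤ b * L := hsb.trans (le_mul_of_one_le_right (by linarith) hL)
      have i4 : L ≤ b * L := le_mul_of_one_le_left hL0.le hb1
      have i5 : (c₃ + 1) * (s * L) ≤ (c₃ + 1) * (b * L) :=
        mul_le_mul_of_nonneg_left i2 (by linarith)
      have i6 : (1000 + 400 * (8 + c₃ + c₄)) * (b * L) ≤ M * (b * L) :=
        mul_le_mul_of_nonneg_right hM (by positivity)
      have i7 : 0 ≤ b * L := by positivity
      linarith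
    have key2 := mul_le_mul_of_nonneg_right (Real.exp_le_exp.2 key) hg0
    simp only [Real.exp_add] at key2
    have key3 := mul_le_mul_of_nonneg_left hpe
      (mul_nonneg (Real.exp_pos (-(M / 400 * (sbar c₄ θ j * Real.log p)))).le hg0)
    linarith

end Column

/-! ### From columns to the matrix, and from regular data to expectations -/

section Posterior

variable {c₁ c₂ c₃ c₄ : ℝ} {π : Finset (Fin p) → ℝ} {θ : Matrix (Fin p) (Fin p) ℝ} {r κ : ℝ}
  {z : Fin n → Fin p → Fin 2}

lemma SparsityPrior.pos (hc₄ : 0 < c₄) (hπ : SparsityPrior c₁ c₂ c₃ c₄ p π)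
    (hL : 0 < Real.log p)
    (hβ : 4 * (c₂ / (p : ℝ) ^ c₄) ≤ Real.exp (-(3 / 4 * c₄ * Real.log p)))
    (hγ : Real.exp (-((c₃ + 1) * Real.log p)) ≤ c₁ / (p : ℝ) ^ c₃) (δ : Finset (Fin p)) :
    0 < π δ := by
  obtain ⟨g, h0, hsum, hg, hgπ⟩ := hπ
  have hδ : δ.card ≤ p := by simpa using Finset.card_le_univ δ
  have h1 := prior_zero_pos (by positivity) h0 hsum (fun s h1 h2 => (hg s h1 h2).2) hβ
  have h2 := le_prior h0 (fun s h1 h2 => (hg s h1 h2).1) hγ _ hδ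
  rw [hgπ]
  exact div_pos ((mul_pos (Real.exp_pos _) h1).trans_le h2)
    (Nat.cast_pos.2 (Nat.choose_pos hδ))

lemma frobNorm_sq (A : Matrix (Fin p) (Fin p) ℝ) : frobNorm A ^ 2 = ∑ j, ∑ k, A k j ^ 2 := by
  have h : (Aᵀ * A).trace = ∑ j, ∑ k, A k j ^ 2 := by
    simp only [Matrix.trace, Matrix.diag, Matrix.mul_apply, Matrix.transpose_apply, sq]
  rw [frobNorm, Real.sq_sqrt, h]
  rw [h]
  exact Finset.sum_nonneg fun _ _ => Finset.sum_nonneg fun _ _ => sq_nonneg _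

/-- If the Frobenius distance exceeds the total rate, then some column exceeds its own rate. -/
lemma exists_column_far {A : Matrix (Fin p) (Fin p) ℝ} {b : Fin p → ℝ} {M L : ℝ} (hM : 0 ≤ M)
    (hb : ∀ j, 0 ≤ b j) (hL : 0 ≤ L)
    (h : M * Real.sqrt ((∑ j, b j) * L / n) < frobNorm A) :
    ∃ j, M ^ 2 * (b j * L / n) < ∑ k, A k j ^ 2 := by
  have hS : 0 ≤ (∑ j, b j) * L / n := by
    have := Finset.sum_nonneg fun j (_ : j ∈ Finset.univ) => hb j
    positivity
  have h1 := pow_lt_pow_left₀ h (by positivity) two_ne_zero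
  rw [mul_pow, Real.sq_sqrt hS, frobNorm_sq, Finset.sum_mul, Finset.sum_div, Finset.mul_sum] at h1
  obtain ⟨j, -, hj⟩ := Finset.exists_lt_of_sum_lt h1
  exact ⟨j, hj⟩

lemma measure_iUnion_le_mul {E : Type*} [MeasurableSpace E] (μ : Measure E) {η : ℝ≥0∞}
    {A : Fin p → Set E} (h : ∀ j, μ (A j) ≤ η) : μ (⋃ j, A j) ≤ p * η := by
  calc _ ≤ ∑ _j : Fin p, η :=
        (measure_iUnion_fintype_le _ _).trans (Finset.sum_le_sum fun j _ => h j)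
    _ = _ := by simp

lemma natCast_mul_exp_neg_two_mul_log (hp : 0 < p) :
    (p : ℝ≥0∞) * ENNReal.ofReal (Real.exp (-(2 * Real.log p))) = ENNReal.ofReal (1 / p) := by
  have hp' : (0 : ℝ) < p := Nat.cast_pos.2 hp
  rw [← ENNReal.ofReal_natCast, ← ENNReal.ofReal_mul hp'.le]
  congr 1
  rw [two_mul, neg_add, Real.exp_add, Real.exp_neg, Real.exp_log hp']
  field_simp

/-- The contraction of the quasi-posterior on regular data. -/
lemma quasiPosterior_le_of_regularData (hc₃ : 0 < c₃) (hc₄ : 0 < c₄)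
    (hπ : SparsityPrior c₁ c₂ c₃ c₄ p π) (hL : 1 ≤ Real.log p) (hp : 2 ≤ p)
    (hβ : 4 * (c₂ / (p : ℝ) ^ c₄) ≤ Real.exp (-(3 / 4 * c₄ * Real.log p)))
    (hγ : Real.exp (-((c₃ + 1) * Real.log p)) ≤ c₁ / (p : ℝ) ^ c₃)
    (hκ : 0 < (kappa c₄ θ).toReal) (hn : 0 < n)
    (hz : RegularData θ (priorScale n p / 2)
      (n * (kappa c₄ θ).toReal / (128 * ∑ j, (sbar c₄ θ j : ℝ))) z)
    (hρS : 64 * priorScale n p * ∑ j, (sbar c₄ θ j : ℝ) ≤ n * (kappa c₄ θ).toReal)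
    {M : ℝ} (hM : 1000 + 400 * (8 + c₃ + c₄) ≤ M) :
    quasiPosterior π (priorScale n p) z {θ' | ∃ j, zeta c₄ θ j < (l0 fun k => θ' k j : ℝ)} ≤
      ENNReal.ofReal (1 / p) ∧
    quasiPosterior π (priorScale n p) z {θ' | M / (kappaSparse θ (sbarMax c₄ θ)).toReal *
        Real.sqrt ((∑ j, (sbar c₄ θ j : ℝ)) * Real.log p / n) < frobNorm (θ' - θ)} ≤
      ENNReal.ofReal (2 / p) := by
  have hL0 : 0 < Real.log p := by linarith
  have hp0 : 0 < p := by omega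
  have hn' : (0 : ℝ) < n := Nat.cast_pos.2 hn
  have hρ : 0 < priorScale n p := by rw [priorScale]; positivity
  have hM0 : 0 < M := by linarith
  let j₀ : Fin p := ⟨0, hp0⟩
  have hks1 : kappaSparse θ (sbarMax c₄ θ) ≤ 1 :=
    kappaSparse_le_one ((one_le_sbar hc₄ hL0 j₀).trans (sbar_le_sbarMax j₀)) j₀
  have hks : (kappa c₄ θ).toReal ≤ (kappaSparse θ (sbarMax c₄ θ)).toReal :=
    ENNReal.toReal_mono (ne_top_of_le_ne_top ENNReal.one_ne_top hks1) (min_le_right _ _)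
  have hks1' : (kappaSparse θ (sbarMax c₄ θ)).toReal ≤ 1 := by
    simpa using ENNReal.toReal_mono ENNReal.one_ne_top hks1
  have hkc : ENNReal.ofReal (kappa c₄ θ).toReal ≤ kappaCone θ :=
    ENNReal.ofReal_toReal_le.trans (min_le_left _ _)
  have hbS := sbar_le_sum (c₄ := c₄) (θ := θ)
  have hS1 : (1 : ℝ) ≤ ∑ j, (sbar c₄ θ j : ℝ) :=
    le_trans (by exact_mod_cast one_le_sbar (θ := θ) hc₄ hL0 j₀) (hbS j₀)
  have hsS : ∀ j, (colSparsity θ j : ℝ) ≤ ∑ j, (sbar c₄ θ j : ℝ) := fun j =>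
    (colSparsity_le_sbar hc₄ hL0 j).trans (hbS j)
  set S := ∑ j, (sbar c₄ θ j : ℝ)
  set κ := (kappa c₄ θ).toReal
  set K := (kappaSparse θ (sbarMax c₄ θ)).toReal
  have hr : 0 ≤ n * κ / (128 * S) := by positivity
  -- The radius r is chosen so that 128 r S = nκ, which serves every column at once.
  have hrS : ∀ a : ℝ, a ≤ S → 128 * (n * κ / (128 * S)) * a ≤ n * κ := by
    intro a ha
    have e : 128 * (n * κ / (128 * S)) * a = n * κ * (a / S) := by field_simp
    rw [e]
    exact mul_le_of_le_one_right (by positivity) ((div_le_one (by positivity)).2 ha)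
  have hρS' : ∀ a : ℝ, a ≤ S → 64 * priorScale n p * a ≤ n * κ := fun a ha =>
    (mul_le_mul_of_nonneg_left ha (by positivity)).trans hρS
  have hnK : n * κ ≤ n * K := mul_le_mul_of_nonneg_left hks hn'.le
  have hpos : ∀ j, columnMass π (priorScale n p) z j Set.univ ≠ 0 := by
    intro j
    refine ((lt_of_lt_of_le ?_ (le_columnMass_univ (π := π) hz hρ j))).ne'
    exact ENNReal.mul_pos
      (ENNReal.ofReal_pos.2 (hπ.pos hc₄ hL0 hβ hγ _)).ne'
      (ENNReal.ofReal_pos.2 (mul_pos (penalizedLik_pos _ _ _ _) (Real.exp_pos _))).ne'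
  have hdense : ∀ j, quasiPosterior π (priorScale n p) z
      {θ' | (fun k => θ' k j) ∈ {u : Fin p → ℝ | zeta c₄ θ j < l0 u}} ≤
      ENNReal.ofReal (Real.exp (-(2 * Real.log p))) := by
    intro j
    rw [quasiPosterior_column_eq hπ.nonneg hρ z hpos j (measurableSet_lt_l0 _)]
    exact columnMass_dense_div_le hc₄ hπ hL0 hp0 hβ hz hr hn hκ hkc j (hrS _ (hsS j))
      (hρS' _ (hsS j))
  have hfar : ∀ j, quasiPosterior π (priorScale n p) z
      {θ' | (fun k => θ' k j) ∈ {u : Fin p → ℝ | ¬ zeta c₄ θ j < l0 u ∧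
        (M / K) ^ 2 * (sbar c₄ θ j * Real.log p / n) < ∑ k, (u k - θ k j) ^ 2}} ≤
      ENNReal.ofReal (Real.exp (-(2 * Real.log p))) := by
    intro j
    rw [quasiPosterior_column_eq hπ.nonneg hρ z hpos j]
    · refine columnMass_far_div_le hc₃ hc₄ hπ hL hp hβ hγ hz hr hn (hκ.trans_le hks) hks1' j hM
        ?_ ((hρS' _ (hbS j)).trans hnK)
      have h1 := hrS _ (hbS j)
      have h2 : 0 ≤ n * κ / (128 * S) * sbar c₄ θ j := by positivity
      linarith
    · refine MeasurableSet.inter (measurableSet_lt_l0 _).compl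
        (measurableSet_lt (f := fun _ : Fin p → ℝ => _)
          (g := fun u : Fin p → ℝ => ∑ k, (u k - θ k j) ^ 2) measurable_const ?_)
      exact Finset.measurable_sum _ fun k _ => ((measurable_pi_apply k).sub_const _).pow_const 2
  have hU1 := measure_iUnion_le_mul _ hdense
  have hU2 := measure_iUnion_le_mul _ hfar
  rw [natCast_mul_exp_neg_two_mul_log hp0] at hU1 hU2
  refine ⟨(measure_mono fun θ' hθ' => ?_).trans hU1, ?_⟩
  · obtain ⟨j, hj⟩ := hθ'
    exact Set.mem_iUnion.2 ⟨j, hj⟩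
  · have e : ENNReal.ofReal (2 / p) = ENNReal.ofReal (1 / p) + ENNReal.ofReal (1 / p) := by
      rw [← ENNReal.ofReal_add (by positivity) (by positivity)]
      congr 1
      ring
    rw [e]
    refine (measure_mono fun θ' hθ' => ?_).trans
      ((measure_union_le _ _).trans (add_le_add hU1 hU2))
    obtain ⟨j, hj⟩ := exists_column_far (by positivity) (fun j => Nat.cast_nonneg _) hL0.le hθ'
    -- The distant column may also be dense; hence both unions are needed, and 2/p.
    by_cases hl : zeta c₄ θ j < (l0 fun k => θ' k j : ℝ)
    · exact Or.inl (Set.mem_iUnion.2 ⟨j, hl⟩)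
    · exact Or.inr (Set.mem_iUnion.2 ⟨j, hl, hj⟩)

end Posterior

/-- Expectations of posterior probabilities split over the event that the data are regular. -/
lemma lintegral_quasiPosterior_le {Ω : Type*} [MeasurableSpace Ω] {P : Measure Ω}
    [IsProbabilityMeasure P] {X : Fin n → Ω → Fin p → Fin 2} (hX : ∀ i, Measurable (X i))
    (G : (Fin n → Fin p → Fin 2) → Prop) {π : Finset (Fin p) → ℝ} {ρ : ℝ}
    {A : Set (Matrix (Fin p) (Fin p) ℝ)} {a b : ℝ≥0∞}
    (hG : P {ω | ¬ G fun i => X i ω} ≤ a) (h : ∀ z, G z → quasiPosterior π ρ z A ≤ b) :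
    ∫⁻ ω, quasiPosterior π ρ (fun i => X i ω) A ∂P ≤ a + b := by
  have hm : MeasurableSet {ω | ¬ G fun i => X i ω} :=
    (measurable_pi_iff.2 hX) (Set.toFinite {z : Fin n → Fin p → Fin 2 | ¬ G z}).measurableSet
  calc ∫⁻ ω, quasiPosterior π ρ (fun i => X i ω) A ∂P
      ≤ ∫⁻ ω, ({ω | ¬ G fun i => X i ω}.indicator (fun _ => 1) ω + b) ∂P := by
        refine lintegral_mono fun ω => ?_
        by_cases hω : G fun i => X i ω
        · exact (h _ hω).trans le_add_self
        · rw [Set.indicator_of_mem (by exact hω)]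
          exact (quasiPosterior_le_one π ρ _ A).trans le_self_add
    _ = P {ω | ¬ G fun i => X i ω} + b := by
        rw [lintegral_add_right _ measurable_const, lintegral_indicator_const hm, lintegral_const,
          measure_univ, mul_one, one_mul]
    _ ≤ a + b := by gcongr

/-- The conditions on the dimension hold for all large `p`. -/
lemma exists_dimension (c₁ c₂ c₃ c₄ : ℝ) (hc₁ : 0 < c₁) (hc₂ : 0 < c₂) (hc₄ : 0 < c₄) :
    ∃ p₀ : ℕ, ∀ p : ℕ, p₀ ≤ p → 2 ≤ p ∧ 1 ≤ Real.log p ∧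
      4 * (c₂ / (p : ℝ) ^ c₄) ≤ Real.exp (-(3 / 4 * c₄ * Real.log p)) ∧
      Real.exp (-((c₃ + 1) * Real.log p)) ≤ c₁ / (p : ℝ) ^ c₃ := by
  have htop : Filter.Tendsto (fun p : ℕ => Real.log p) Filter.atTop Filter.atTop :=
    Real.tendsto_log_atTop.comp tendsto_natCast_atTop_atTop
  have hev := (htop.eventually_ge_atTop (max 1 (max (4 * Real.log (4 * c₂) / c₄)
    (-Real.log c₁)))).and (Filter.eventually_ge_atTop 2)
  obtain ⟨p₀, hp₀⟩ := Filter.eventually_atTop.1 hev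
  refine ⟨p₀, fun p hp => ?_⟩
  obtain ⟨h, hp2⟩ := hp₀ p hp
  have h1 := (le_max_left _ _).trans h
  have h2 := ((le_max_left _ _).trans (le_max_right _ _)).trans h
  have h3 := ((le_max_right _ _).trans (le_max_right _ _)).trans h
  have hp' : (0 : ℝ) < p := by positivity
  have hpow : ∀ c : ℝ, (p : ℝ) ^ c = Real.exp (c * Real.log p) := fun c => by
    rw [Real.rpow_def_of_pos hp', mul_comm]
  refine ⟨hp2, h1, ?_, ?_⟩
  -- A quarter of the exponent c₄ log p absorbs 4c₂; below, the extra log p in c₃ + 1 absorbs c₁.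
  · rw [hpow, ← mul_div_assoc, div_le_iff₀ (Real.exp_pos _), ← Real.exp_add,
      ← Real.log_le_iff_le_exp (by positivity)]
    rw [div_le_iff₀ hc₄] at h2
    linarith
  · rw [hpow, le_div_iff₀ (Real.exp_pos _), ← Real.exp_add, ← Real.le_log_iff_exp_le hc₁]
    linarith

/-- The failure probability of the regularity of the data. -/
lemma IsIsingSample.measure_not_regularData_le_inv {Ω : Type*} [MeasurableSpace Ω]
    {P : Measure Ω} [IsProbabilityMeasure P] {X : Fin n → Ω → Fin p → Fin 2}
    {θ : Matrix (Fin p) (Fin p) ℝ} (hX : IsIsingSample P θ X) (hθ : θ.IsSymm) (hp : 2 ≤ p)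
    (hn : 0 < n) {S κ : ℝ} (hS : 0 < S) (hκ : 0 < κ)
    (h : 10 ^ 7 * (S / κ) ^ 2 * Real.log p ≤ n) :
    P {ω | ¬ RegularData θ (priorScale n p / 2) (n * κ / (128 * S)) fun i => X i ω} ≤
      ENNReal.ofReal (1 / p) := by
  have hn' : (0 : ℝ) < n := Nat.cast_pos.2 hn
  have hp2 : (2 : ℝ) ≤ p := by exact_mod_cast hp
  have hL : 0 < Real.log p := Real.log_pos (by linarith)
  have hη : Real.exp (-(8 * Real.log p)) = 1 / (p : ℝ) ^ 8 := by
    rw [Real.exp_neg, mul_comm, Real.exp_mul, Real.exp_log (by linarith), one_div]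
    norm_cast
  -- Tails of order p⁻⁸ suffice, as 2(p² + p³) ≤ p⁷ for p ≥ 2.
  refine (hX.measure_not_regularData_le hθ (η := Real.exp (-(8 * Real.log p)))
    (by rw [priorScale]; positivity) (by positivity) (Real.exp_le_exp.2 ?_)
    (Real.exp_le_exp.2 ?_)).trans (ENNReal.ofReal_le_ofReal ?_)
  · rw [div_pow, priorScale_sq]
    have e : -(576 * (n * Real.log p) / 2 ^ 2) / (2 * n) = -(72 * Real.log p) := by
      field_simp
      norm_num
    rw [e]
    linarith
  · have h1 : 10 ^ 7 * S ^ 2 * Real.log p ≤ n * κ ^ 2 := by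
      have e : 10 ^ 7 * (S / κ) ^ 2 * Real.log p = 10 ^ 7 * S ^ 2 * Real.log p / κ ^ 2 := by
        field_simp
      rwa [e, div_le_iff₀ (by positivity)] at h
    have e : -(n * κ / (128 * S)) ^ 2 / (2 * n) = -(n * κ ^ 2 / (32768 * S ^ 2)) := by
      field_simp
      norm_num
    rw [e, neg_le_neg_iff, le_div_iff₀ (by positivity)]
    have : 0 ≤ S ^ 2 * Real.log p := by positivity
    linarith
  · rw [hη]
    have h4 : (2 : ℝ) ^ 4 ≤ (p : ℝ) ^ 4 := pow_le_pow_left₀ (by norm_num) hp2 4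
    have h23 : (p : ℝ) ^ 2 ≤ (p : ℝ) ^ 3 := pow_le_pow_right₀ (by linarith) (by norm_num)
    have e : (1 : ℝ) / p = (p : ℝ) ^ 7 * (1 / (p : ℝ) ^ 8) := by
      field_simp
    rw [e, ← mul_assoc]
    refine mul_le_mul_of_nonneg_right ?_ (by positivity)
    have h7 : (p : ℝ) ^ 7 = (p : ℝ) ^ 3 * (p : ℝ) ^ 4 := by ring
    have h3 : 0 ≤ (p : ℝ) ^ 3 := by positivity
    nlinarith

end IsingQP

/-! ### Assembly of the theorem. -/

open IsingQP
theorem theorem3 :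
    ∃ A₁ A₂ : ℝ, 0 < A₁ ∧ 0 < A₂ ∧
    ∀ c₁ c₂ c₃ c₄ : ℝ, 0 < c₁ → 0 < c₂ → 0 < c₄ → c₄ ≤ c₃ →
    ∃ M₀ : ℝ, 2 < M₀ ∧ ∃ p₀ : ℕ, ∀ p : ℕ, p₀ ≤ p →
    ∀ (π : Finset (Fin p) → ℝ), SparsityPrior c₁ c₂ c₃ c₄ p π →
    ∀ (θs : Matrix (Fin p) (Fin p) ℝ), θs.IsSymm → 0 < kappa c₄ θs →
    ∀ n : ℕ, A₁ * ((∑ j, (sbar c₄ θs j : ℝ)) / (kappa c₄ θs).toReal) ^ 2 * Real.log p ≤ (n : ℝ) →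
    ∀ (Ω : Type*) [MeasurableSpace Ω] (P : Measure Ω) [IsProbabilityMeasure P]
      (X : Fin n → Ω → Fin p → Fin 2), IsIsingSample P θs X →
      (∫⁻ ω, quasiPosterior π (priorScale n p) (fun i => X i ω)
            {θ | ∃ j, zeta c₄ θs j < (l0 fun k => θ k j : ℝ)} ∂P
          ≤ ENNReal.ofReal (Real.exp (-A₂ * n) + 4 / p)) ∧
      (∫⁻ ω, quasiPosterior π (priorScale n p) (fun i => X i ω)
            {θ | M₀ / (kappaSparse θs (sbarMax c₄ θs)).toReal *
                Real.sqrt ((∑ j, (sbar c₄ θs j : ℝ)) * Real.log p / n)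
              < frobNorm (θ - θs)} ∂P
          ≤ ENNReal.ofReal (2 * Real.exp (-A₂ * n) + 12 / p)) := by
  -- The value A₂ = 1 is arbitrary: the proof gives 2/p and 3/p, so the exponential terms are slack.
  refine ⟨10 ^ 7, 1, by norm_num, one_pos, fun c₁ c₂ c₃ c₄ hc₁ hc₂ hc₄ hc₃₄ => ?_⟩
  have hc₃ : 0 < c₃ := hc₄.trans_le hc₃₄
  obtain ⟨p₀, hp₀⟩ := exists_dimension c₁ c₂ c₃ c₄ hc₁ hc₂ hc₄
  refine ⟨1000 + 400 * (8 + c₃ + c₄), by linarith, p₀, fun p hp π hπ θ hθ hκ n hn Ω _ P _ X hX => ?_⟩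
  obtain ⟨hp2, hL, hβ, hγ⟩ := hp₀ p hp
  have hL0 : 0 < Real.log p := by linarith
  let j₀ : Fin p := ⟨0, by omega⟩
  have hκ' : 0 < (kappa c₄ θ).toReal :=
    ENNReal.toReal_pos hκ.ne' (ne_top_of_le_ne_top ENNReal.one_ne_top (kappa_le_one hc₄ hL0 j₀))
  have hS : 0 < ∑ j, (sbar c₄ θ j : ℝ) :=
    lt_of_lt_of_le (by exact_mod_cast one_le_sbar (θ := θ) hc₄ hL0 j₀) (sbar_le_sum j₀)
  have hn0 : 0 < n := by
    have : (0 : ℝ) < n := lt_of_lt_of_le (by positivity) hn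
    exact_mod_cast this
  have hbad := hX.measure_not_regularData_le_inv hθ hp2 hn0 hS hκ' hn
  have hgood := fun z hz => quasiPosterior_le_of_regularData (z := z) hc₃ hc₄ hπ hL hp2 hβ hγ hκ'
    hn0 hz (priorScale_mul_le hS.le hκ' hn) le_rfl
  have hp' : (0 : ℝ) < p := by positivity
  constructor
  · refine (lintegral_quasiPosterior_le hX.measurable _ hbad fun z hz => (hgood z hz).1).trans ?_
    rw [← ENNReal.ofReal_add (by positivity) (by positivity)]
    refine ENNReal.ofReal_le_ofReal ?_
    have h1 := Real.exp_pos (-1 * (n : ℝ))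
    have h2 : 1 / (p : ℝ) + 1 / p ≤ 4 / p := by
      rw [← add_div]
      gcongr
      norm_num
    linarith
  · refine (lintegral_quasiPosterior_le hX.measurable _ hbad fun z hz => (hgood z hz).2).trans ?_
    rw [← ENNReal.ofReal_add (by positivity) (by positivity)]
    refine ENNReal.ofReal_le_ofReal ?_
    have h1 := Real.exp_pos (-1 * (n : ℝ))
    have h2 : 1 / (p : ℝ) + 2 / p ≤ 12 / p := by
      rw [← add_div]
      gcongr
      norm_num
    linarith
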